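/- Let $C$ be a non-singular, projective, geometrically irreducible curve over $\mathbb{Q}$ with function field $F=\mathbb{Q}(C)$. Let $K_2(F)=F^*\otimes_{\mathbb Z}F^*/\langle a\otimes(1-a): a\in F,\ a\neq 0,1\rangle$, write $\{a,b\}$ for the class of $a\otimes b$, and let $$K_2^T(C)=\ker\Bigl(K_2(F)\to\prod_{x\in C(\overline{\mathbb Q})}\overline{\mathbb Q}^*\Bigr),\qquad \{a,b\}\mapsto\Bigl((-1)^{\mathrm{ord}_x(a)\,\mathrm{ord}_x(b)}\,\frac{a^{\mathrm{ord}_x(b)}}{b^{\mathrm{ord}_x(a)}}(x)\Bigr)_x .$$ For three distinct points $Q_1,Q_2,Q_3\in C(\mathbb{Q})$ whose pairwise differences are torsion in the divisor class group, and with indices read modulo $3$, let $m_i$ be the order of the class of $(Q_{i+1})-(Q_{i-1})$, choose $f_i\in F^*$ with $\mathrm{div}(f_i)=m_i(Q_{i+1})-m_i(Q_{i-1})$, and put $$S_i=\Bigl\{\frac{f_{i+1}}{f_{i+1}(Q_{i+1})},\ \frac{f_{i-1}}{f_{i-1}(Q_{i-1})}\Bigr\}\in K_2(F).$$ Then $\{Q_1,Q_2,Q_3\}$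 denotes the element $\xi\in K_2^T(C)/\mathrm{torsion}$ such that, for every choice of the $f_i$ and every $i=1,2,3$, one has $S_i\in K_2^T(C)$ and $S_i=\frac{\mathrm{lcm}(m_1,m_2,m_3)}{m_i}\,\xi$ in $K_2^T(C)/\mathrm{torsion}$. Proposition. Let $P_1,P_2,P_3,P_4\in C(\mathbb{Q})$ be four distinct points such that all $(P_i)-(P_j)$ are torsion in the divisor class group. Then the four elements $\{P_1,\dots,\widehat{P_i},\dots,P_4\}$ $(1\le i\le 4)$ exist and are uniquely determined by the property above, and they are linearly dependent over $\mathbb{Z}$. More precisely, if $m_{ij}$ is the order of the class of $(P_i)-(P_j)$, then $$\sum_{i=1}^4(-1)^i\,c_i\,\{P_1,\dots,\widehat{P_i},\dots,P_4\}=0\quad\text{in } K_2^T(C)/\mathrm{torsion},\qquad c_i=\gcd(m_{ij},m_{ik},m_{il}),\quad \{i,j,k,l\}=\{1,2,3,4\}.$$ -/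

import Mathlib

open CategoryTheory AlgebraicGeometry
open scoped TensorProduct

noncomputable section

/-! ### The group `K₂` of a field -/

/-- The subgroup of `Fˣ ⊗ Fˣ` generated by all `a ⊗ (1 - a)` with `a ≠ 0, 1`. -/
def steinbergSubgroup (F : Type) [Field F] :
    AddSubgroup (Additive Fˣ ⊗[ℤ] Additive Fˣ) :=
  AddSubgroup.closure
    {t | ∃ a b : Fˣ, (a : F) + (b : F) = 1 ∧ t = Additive.ofMul a ⊗ₜ[ℤ] Additive.ofMul b}

/-- `K₂(F) = Fˣ ⊗ Fˣ / ⟨a ⊗ (1 - a)⟩`, written additively. -/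
abbrev K2 (F : Type) [Field F] : Type :=
  (Additive Fˣ ⊗[ℤ] Additive Fˣ) ⧸ steinbergSubgroup F

/-- The symbol `{a, b}` in `K₂(F)`. -/
def K2.symbol {F : Type} [Field F] (a b : Fˣ) : K2 F :=
  QuotientAddGroup.mk (Additive.ofMul a ⊗ₜ[ℤ] Additive.ofMul b)

/-! ### Order, value and tame symbol for a discrete valuation ring -/

namespace TameSymbol

variable (A : Type) {K L : Type} [CommRing A] [IsDomain A] [IsDiscreteValuationRing A]
  [Field K] [Algebra A K] [IsFractionRing A K] [Field L]

/-- The order of `u ∈ Kˣ` with respect to the discrete valuation ring `A` with fraction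
field `K`; it is `1` on a uniformizer. -/
def ord (u : Kˣ) : ℤ :=
  -WithZero.log ((IsDiscreteValuationRing.maximalIdeal A).valuation K (u : K))

lemma ord_mul (u w : Kˣ) : ord A (u * w) = ord A u + ord A w := by
  unfold ord
  rw [Units.val_mul, map_mul, WithZero.log_mul (by simp) (by simp)]
  ring

lemma ord_one : ord A (1 : Kˣ) = 0 := by simp [ord]

lemma ord_inv (u : Kˣ) : ord A u⁻¹ = -ord A u := by
  have := ord_mul A u u⁻¹
  rw [mul_inv_cancel, ord_one] at this
  linarith

lemma ord_zpow (u : Kˣ) (n : ℤ) : ord A (u ^ n) = n * ord A u := by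
  unfold ord
  rw [Units.val_zpow_eq_zpow_val, map_zpow₀, WithZero.log_zpow, smul_eq_mul]
  ring

lemma ord_nonneg_iff (u : Kˣ) :
    0 ≤ ord A u ↔ (IsDiscreteValuationRing.maximalIdeal A).valuation K (u : K) ≤ 1 := by
  unfold ord
  rw [neg_nonneg, WithZero.log_le_iff_le_exp (by simp), WithZero.exp_zero]

lemma exists_of_ord_nonneg {u : Kˣ} (h : 0 ≤ ord A u) :
    ∃ a : A, algebraMap A K a = u :=
  IsDiscreteValuationRing.exists_lift_of_le_one ((ord_nonneg_iff A u).1 h)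

lemma exists_unit_of_ord_eq_zero {u : Kˣ} (h : ord A u = 0) :
    ∃ a : Aˣ, Units.map (algebraMap A K).toMonoidHom a = u := by
  obtain ⟨a, ha⟩ := exists_of_ord_nonneg A h.ge
  obtain ⟨b, hb⟩ := exists_of_ord_nonneg A (u := u⁻¹) (by rw [ord_inv, h, neg_zero])
  have hab : a * b = 1 := by
    apply IsFractionRing.injective A K
    rw [map_mul, ha, hb, map_one]
    simp
  refine ⟨⟨a, b, hab, by rw [mul_comm, hab]⟩, Units.ext ?_⟩
  simpa using ha

variable {A}

/-- For `φ : A → L` (evaluation at a point) and `u ∈ Kˣ` of order zero, the value `u(x) ∈ Lˣ`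
obtained by applying `φ` to the unit `u` of `A`. It is set to `1` if `u` is not a unit of `A`. -/
def value (φ : A →+* L) (u : Kˣ) : Lˣ :=
  open Classical in
  if h : ∃ a : Aˣ, Units.map (algebraMap A K).toMonoidHom a = u then
    Units.map φ.toMonoidHom h.choose else 1

lemma value_map (φ : A →+* L) (a : Aˣ) :
    value φ (Units.map (algebraMap A K).toMonoidHom a) = Units.map φ.toMonoidHom a := by
  have h : ∃ b : Aˣ, Units.map (algebraMap A K).toMonoidHom b =
    Units.map (algebraMap A K).toMonoidHom a := ⟨a, rfl⟩
  unfold value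
  rw [dif_pos h, Units.map_injective (IsFractionRing.injective A K) h.choose_spec]

lemma value_mul (φ : A →+* L) {u w : Kˣ} (hu : ord A u = 0) (hw : ord A w = 0) :
    value φ (u * w) = value φ u * value φ w := by
  obtain ⟨a, rfl⟩ := exists_unit_of_ord_eq_zero A hu
  obtain ⟨b, rfl⟩ := exists_unit_of_ord_eq_zero A hw
  rw [← map_mul, value_map, value_map, value_map, map_mul]

lemma value_zpow (φ : A →+* L) {u : Kˣ} (hu : ord A u = 0) (n : ℤ) :
    value φ (u ^ n) = value φ u ^ n := by
  obtain ⟨a, rfl⟩ := exists_unit_of_ord_eq_zero A hu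
  rw [← map_zpow, value_map, value_map, map_zpow]

lemma value_one (φ : A →+* L) : value φ (1 : Kˣ) = 1 := by
  simpa using value_zpow φ (ord_one A (K := K)) 0

/-- The tame symbol `(-1)^(ord a · ord b) · (a^(ord b) / b^(ord a))(x)`. -/
def tame (φ : A →+* L) (a b : Kˣ) : Lˣ :=
  (-1) ^ (ord A a * ord A b) * value φ (a ^ ord A b / b ^ ord A a)

lemma ord_tame_arg (a b : Kˣ) : ord A (a ^ ord A b / b ^ ord A a) = 0 := by
  rw [div_eq_mul_inv, ord_mul, ord_inv, ord_zpow, ord_zpow]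
  ring

lemma tame_mul_left (φ : A →+* L) (a a' b : Kˣ) :
    tame φ (a * a') b = tame φ a b * tame φ a' b := by
  unfold tame
  have h : (a * a') ^ ord A b / b ^ ord A (a * a') =
      (a ^ ord A b / b ^ ord A a) * (a' ^ ord A b / b ^ ord A a') := by
    rw [ord_mul, mul_zpow, zpow_add, mul_div_mul_comm]
  rw [h, value_mul φ (ord_tame_arg a b) (ord_tame_arg a' b), ord_mul, add_mul, zpow_add]
  exact mul_mul_mul_comm _ _ _ _

lemma tame_mul_right (φ : A →+* L) (a b b' : Kˣ) :
    tame φ a (b * b') = tame φ a b * tame φ a b' := by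
  unfold tame
  have h : a ^ ord A (b * b') / (b * b') ^ ord A a =
      (a ^ ord A b / b ^ ord A a) * (a ^ ord A b' / b' ^ ord A a) := by
    rw [ord_mul, mul_zpow, zpow_add, mul_div_mul_comm]
  rw [h, value_mul φ (ord_tame_arg a b) (ord_tame_arg a b'), ord_mul, mul_add, zpow_add]
  exact mul_mul_mul_comm _ _ _ _

lemma map_eq_zero_of_ord_pos (φ : A →+* L) [IsLocalHom φ] {u : Kˣ} (h : 0 < ord A u) {a : A}
    (ha : algebraMap A K a = u) : φ a = 0 := by
  by_contra hne
  have hunit : IsUnit a := isUnit_of_map_unit φ a (isUnit_iff_ne_zero.2 hne)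
  obtain ⟨b, hb⟩ := hunit.exists_right_inv
  have hle : 0 ≤ ord A u⁻¹ := by
    rw [ord_nonneg_iff]
    have : ((u⁻¹ : Kˣ) : K) = algebraMap A K b := by
      rw [Units.inv_eq_of_mul_eq_one_right]
      rw [← ha, ← map_mul, hb, map_one]
    rw [this]
    exact IsDedekindDomain.HeightOneSpectrum.valuation_le_one _ _
  rw [ord_inv] at hle
  linarith

/-- If `u ≡ c` modulo the maximal ideal with `c = ±1`, the value of `u` is `c`. -/
lemma value_eq_of_add (φ : A →+* L) [IsLocalHom φ] {u w : Kˣ} (hu : 0 < ord A u) (c : ℤˣ)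
    (h : (w : K) = ((c : ℤ) : K) + u) :
    ord A w = 0 ∧ value φ w = Units.map (Int.castRingHom L).toMonoidHom c := by
  obtain ⟨a, ha⟩ := exists_of_ord_nonneg A hu.le
  have hφ := map_eq_zero_of_ord_pos φ hu ha
  have hφc : φ (((c : ℤ) : A) + a) = ((c : ℤ) : L) := by simp [hφ]
  have hcu : IsUnit (((c : ℤ) : A) + a) := by
    apply isUnit_of_map_unit φ
    rw [hφc]
    exact c.isUnit.map (Int.castRingHom L)
  obtain ⟨d, hd⟩ := hcu
  have hw : w = Units.map (algebraMap A K).toMonoidHom d := by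
    apply Units.ext
    rw [h]
    simp [hd, ha]
  refine ⟨?_, ?_⟩
  · have h1 : 0 ≤ ord A w := by
      rw [hw, ord_nonneg_iff]
      exact IsDedekindDomain.HeightOneSpectrum.valuation_le_one _ _
    have h2 : 0 ≤ ord A w⁻¹ := by
      rw [hw, ← map_inv, ord_nonneg_iff]
      exact IsDedekindDomain.HeightOneSpectrum.valuation_le_one _ _
    rw [ord_inv] at h2
    linarith
  · rw [hw, value_map]
    apply Units.ext
    simpa [hd] using hφc

lemma tame_comm (φ : A →+* L) (a b : Kˣ) : tame φ a b = (tame φ b a)⁻¹ := by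
  unfold tame
  have h : a ^ ord A b / b ^ ord A a = (b ^ ord A a / a ^ ord A b) ^ (-1 : ℤ) := by
    rw [zpow_neg_one, inv_div]
  rw [h, value_zpow φ (ord_tame_arg b a), mul_inv, zpow_neg_one, ← zpow_neg]
  congr 1
  rw [mul_comm (ord A a), zpow_neg, ← inv_zpow]
  simp

lemma tame_steinberg_pos (φ : A →+* L) [IsLocalHom φ] {a b : Kˣ} (hab : (a : K) + b = 1)
    (ha : 0 < ord A a) : tame φ a b = 1 := by
  have hna : ord A (-a) = ord A a := by simp [ord]
  obtain ⟨h0, h1⟩ := value_eq_of_add φ (u := -a) (w := b) (by rw [hna]; exact ha) 1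
    (by simp [← hab])
  have hv : value φ (b ^ ord A a)⁻¹ = 1 := by
    rw [← zpow_neg, value_zpow φ h0, h1]
    simp
  unfold tame
  rw [h0, mul_zero, zpow_zero, zpow_zero, one_mul, one_div, hv]

lemma tame_steinberg (φ : A →+* L) [IsLocalHom φ] {a b : Kˣ} (hab : (a : K) + b = 1) :
    tame φ a b = 1 := by
  rcases lt_trichotomy (ord A a) 0 with ha | ha | ha
  · have hc : 0 < ord A a⁻¹ := by rw [ord_inv]; linarith
    obtain ⟨h0, h1⟩ := value_eq_of_add φ (u := a⁻¹) (w := b * a⁻¹) hc (-1) (by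
      have hb : (b : K) = 1 - a := by rw [← hab]; ring
      push_cast
      rw [hb, sub_mul, mul_inv_cancel₀ a.ne_zero]
      ring)
    have hord : ord A b = ord A a := by
      rw [ord_mul, ord_inv] at h0
      linarith
    have harg : a ^ ord A b / b ^ ord A a = (b * a⁻¹) ^ (-ord A a) := by
      rw [hord, ← div_zpow, zpow_neg, ← inv_zpow, mul_inv, inv_inv, mul_comm, div_eq_mul_inv]
    unfold tame
    rw [harg, value_zpow φ h0, h1, hord]
    have h2 : (Units.map (Int.castRingHom L).toMonoidHom (-1) : Lˣ) = -1 := by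
      apply Units.ext
      simp
    rw [h2, ← zpow_add]
    have h3 : Even (ord A a * ord A a + -ord A a) := by
      have := Int.even_mul_pred_self (ord A a)
      convert this using 1
      ring
    exact h3.neg_one_zpow
  · rcases lt_trichotomy (ord A b) 0 with hb | hb | hb
    · exfalso
      obtain ⟨x, hx⟩ := exists_of_ord_nonneg A ha.ge
      have : 0 ≤ ord A b := by
        rw [ord_nonneg_iff]
        have hb' : (b : K) = algebraMap A K (1 - x) := by
          rw [map_sub, map_one, hx, ← hab]
          ring
        rw [hb']
        exact IsDedekindDomain.HeightOneSpectrum.valuation_le_one _ _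
      linarith
    · unfold tame
      simp [ha, hb, value_one]
    · rw [tame_comm, tame_steinberg_pos φ (by rw [add_comm]; exact hab) hb, inv_one]
  · exact tame_steinberg_pos φ hab ha

/-- The homomorphism `K₂(K) → Lˣ` (target written additively) sending `{a, b}` to its tame
symbol. -/
def tameHom (φ : A →+* L) [IsLocalHom φ] : K2 K →+ Additive Lˣ :=
  QuotientAddGroup.lift (steinbergSubgroup K)
    (TensorProduct.liftAddHom
      (AddMonoidHom.mk'
        (fun a : Additive Kˣ => AddMonoidHom.mk'
          (fun b : Additive Kˣ => Additive.ofMul (tame φ a.toMul b.toMul))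
          (fun b b' => by
            rw [toMul_add, tame_mul_right, ofMul_mul]))
        (fun a a' => by
          refine AddMonoidHom.ext fun b => ?_
          change Additive.ofMul (tame φ (a + a').toMul b.toMul) =
            Additive.ofMul (tame φ a.toMul b.toMul) + Additive.ofMul (tame φ a'.toMul b.toMul)
          rw [toMul_add, tame_mul_left, ofMul_mul]))
      (fun r a b => by
        rw [map_zsmul, map_zsmul]
        rfl))
    ((AddSubgroup.closure_le _).2 (by
      rintro _ ⟨a, b, hab, rfl⟩
      change Additive.ofMul (tame φ a b) = 0
      rw [tame_steinberg φ hab, ofMul_one]))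

lemma tameHom_symbol (φ : A →+* L) [IsLocalHom φ] (a b : Kˣ) :
    tameHom φ (K2.symbol a b) = Additive.ofMul (tame φ a b) := rfl

end TameSymbol

/-! ### Curves over `ℚ` -/

/-- A non-singular, projective, geometrically irreducible curve over `ℚ`: an integral scheme
which is proper (for curves this is the same as projective) and geometrically irreducible over
`ℚ`, whose local ring at every closed point is a regular local ring of dimension one, that is,
a discrete valuation ring. -/
structure NonsingularCurve where
  /-- the underlying scheme -/
  X : Scheme.{0}
  /-- the structure morphism -/
  str : X ⟶ Spec (.of ℚ)
  isIntegral : IsIntegral X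
  isProper : IsProper str
  geomIrred : GeometricallyIrreducible str
  dvr : ∀ x : X, IsClosed {x} → IsDiscreteValuationRing (X.presheaf.stalk x)

namespace NonsingularCurve

instance : Algebra.IsAlgebraic ℚ (AlgebraicClosure ℚ) := by
  have h := AlgebraicClosure.isAlgebraic ℚ
  have e : (DivisionRing.toRatAlgebra : Algebra ℚ (AlgebraicClosure ℚ)) =
    AlgebraicClosure.instAlgebra ℚ := Subsingleton.elim _ _
  rw [e]
  exact h

instance (C : NonsingularCurve) : IsIntegral C.X := C.isIntegral
instance (C : NonsingularCurve) : IsProper C.str := C.isProper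
instance (C : NonsingularCurve) : GeometricallyIrreducible C.str := C.geomIrred

variable (C : NonsingularCurve)

/-- The function field `F = ℚ(C)`. -/
abbrev F : Type := C.X.functionField

/-- The inclusion of the constants `ℚ → ℚ(C)`. -/
def const : ℚ →+* C.F :=
  ((Scheme.ΓSpecIso (.of ℚ)).inv ≫ C.str.appTop ≫
    C.X.presheaf.germ ⊤ (genericPoint C.X) trivial).hom

/-- The closed points of `C`. -/
abbrev ClosedPt : Type := {x : C.X // IsClosed {x}}

instance (x : C.ClosedPt) : IsDiscreteValuationRing (C.X.presheaf.stalk x.1) := C.dvr x.1 x.2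

/-- The order of a non-zero rational function at a closed point. -/
def ord (x : C.ClosedPt) (f : C.Fˣ) : ℤ := TameSymbol.ord (C.X.presheaf.stalk x.1) f

/-- The divisor map, with values in functions on the closed points. -/
def divHom : Additive C.Fˣ →+ (C.ClosedPt → ℤ) :=
  AddMonoidHom.mk' (fun f x => C.ord x f.toMul)
    (fun f g => funext fun _ => TameSymbol.ord_mul _ f.toMul g.toMul)

/-- Divisors on `C`: the free abelian group on the closed points. -/
abbrev Divisor : Type := C.ClosedPt →₀ ℤ

/-- `div(f) = D`. -/
def HasDivisor (f : C.Fˣ) (D : C.Divisor) : Prop := ∀ x, C.ord x f = D x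

/-- The principal divisors: those `D` with `D = div(f)` for some `f`. -/
def principal : AddSubgroup C.Divisor :=
  C.divHom.range.comap Finsupp.coeFnAddHom

lemma mem_principal_iff (D : C.Divisor) : D ∈ C.principal ↔ ∃ f, C.HasDivisor f D := by
  constructor
  · rintro ⟨f, hf⟩
    exact ⟨f.toMul, fun x => congrFun hf x⟩
  · rintro ⟨f, hf⟩
    exact ⟨Additive.ofMul f, funext hf⟩

/-- The divisor class group of `C`. -/
abbrev Pic : Type := C.Divisor ⧸ C.principal

/-- `C(L)`: morphisms `Spec L → C` over `ℚ`. -/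
def Point (L : Type) [Field L] [Algebra ℚ L] : Type :=
  {x : Spec (.of L) ⟶ C.X // x ≫ C.str = Spec.map (CommRingCat.ofHom (algebraMap ℚ L))}

variable {C}

namespace Point

variable {L : Type} [Field L] [Algebra ℚ L]

/-- The point of the scheme `C` underlying an `L`-valued point. -/
def pt (x : C.Point L) : C.X := x.1 (IsLocalRing.closedPoint L)

variable [Algebra.IsAlgebraic ℚ L]

lemma isClosed_pt (x : C.Point L) : IsClosed {x.pt} := by
  have h1 : IsIntegralHom (x.1 ≫ C.str) := by
    rw [x.2, IsIntegralHom.SpecMap_iff]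
    exact algebraMap_isIntegral_iff.2 inferInstance
  have h2 : IsIntegralHom x.1 := IsIntegralHom.of_comp x.1 C.str
  have h3 := x.1.isClosedMap {IsLocalRing.closedPoint L}
    (PrimeSpectrum.isClosed_singleton_iff_isMaximal _ |>.2
      (IsLocalRing.maximalIdeal.isMaximal L))
  have h4 : x.1 '' {IsLocalRing.closedPoint L} = {x.pt} := Set.image_singleton
  exact h4 ▸ h3

/-- The closed point of `C` underlying an `L`-valued point, for `L` algebraic over `ℚ`. -/
def closedPt (x : C.Point L) : C.ClosedPt := ⟨x.pt, x.isClosed_pt⟩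

/-- Evaluation at `x`: the local homomorphism from the local ring of `C` at `x` to `L`. -/
def eval (x : C.Point L) : C.X.presheaf.stalk x.closedPt.1 →+* L :=
  (Scheme.stalkClosedPointTo (R := .of L) x.1).hom

instance (x : C.Point L) : IsLocalHom x.eval :=
  Scheme.isLocalHom_stalkClosedPointTo' x.1

/-- The value `f(x) ∈ Lˣ` of a rational function `f` having neither a zero nor a pole at `x`
(and `1` for all other `f`). -/
def value (x : C.Point L) (f : C.Fˣ) : Lˣ := TameSymbol.value x.eval f

/-- The tame symbol `T_x : K₂(F) → Lˣ`. -/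
def tame (x : C.Point L) : K2 C.F →+ Additive Lˣ := TameSymbol.tameHom x.eval

end Point

variable (C) in
/-- `K₂ᵀ(C)`, the kernel of all tame symbols at points of `C` over an algebraic closure of `ℚ`. -/
def K2T : AddSubgroup (K2 C.F) := ⨅ x : C.Point (AlgebraicClosure ℚ), x.tame.ker

variable (C) in
/-- `K₂ᵀ(C) / torsion`. -/
abbrev K2TModTorsion : Type := C.K2T ⧸ AddCommGroup.torsion C.K2T

/-- The divisor `(P) - (Q)` for rational points `P`, `Q`. -/
def diff (P Q : C.Point ℚ) : C.Divisor :=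
  Finsupp.single P.closedPt 1 - Finsupp.single Q.closedPt 1

/-- The class of `(P) - (Q)` in the divisor class group. -/
def diffClass (P Q : C.Point ℚ) : C.Pic := QuotientAddGroup.mk (diff P Q)

/-- The order of `(P) - (Q)` in the divisor class group (`0` if it is not torsion). -/
def order (P Q : C.Point ℚ) : ℕ := addOrderOf (diffClass P Q)

/-- `f / f(P)`. -/
def normalize (f : C.Fˣ) (P : C.Point ℚ) : C.Fˣ :=
  f / Units.map C.const.toMonoidHom (P.value f)

/-- `S_i = { f_{i+1} / f_{i+1}(P_{i+1}), f_{i-1} / f_{i-1}(P_{i-1}) }`, indices modulo `3`. -/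
def S (P : Fin 3 → C.Point ℚ) (f : Fin 3 → C.Fˣ) (i : Fin 3) : K2 C.F :=
  K2.symbol (normalize (f (i + 1)) (P (i + 1))) (normalize (f (i - 1)) (P (i - 1)))

/-- `ξ` is the element `{P₀, P₁, P₂}` of `K₂ᵀ(C) / torsion`: with `m_i` the order of
`(P_{i+1}) - (P_{i-1})` (indices modulo `3`) and any functions `f_i` with
`div(f_i) = m_i (P_{i+1}) - m_i (P_{i-1})`, the symbols `S_i` lie in `K₂ᵀ(C)` and
`S_i = (lcm(m₀, m₁, m₂) / m_i) ξ` modulo torsion for all `i`. -/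
def IsTripleSymbol (P : Fin 3 → C.Point ℚ) (ξ : C.K2TModTorsion) : Prop :=
  let m : Fin 3 → ℕ := fun i => order (P (i + 1)) (P (i - 1))
  ∀ f : Fin 3 → C.Fˣ,
    (∀ i, C.HasDivisor (f i) (m i • diff (P (i + 1)) (P (i - 1)))) →
    ∀ i, ∃ hS : S P f i ∈ C.K2T,
      (QuotientAddGroup.mk ⟨S P f i, hS⟩ : C.K2TModTorsion) =
        ((Finset.univ.lcm m) / m i) • ξ

end NonsingularCurve

end

/-!
Write `{a, b}` for symbols modulo torsion. The proof has three ingredients: Weil reciprocity for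
functions supported at three rational points, torsion of `K₂(ℚ)`, and an identity between least
common multiples and greatest common divisors.

**Reciprocity.** Let `div a = m (Q) - m (P)` and `div b = n (R) - n (P)`, and let `A` be the ring
of functions regular outside `P`. The residue field at `P` is `ℚ`, and by properness together with
the existence of a rational point the only functions without poles are the constants; hence the
pole order at `P` makes `A` free over `ℚ[a]`, a basis being given by elements of minimal pole order
in each residue class modulo `m` that occurs (`IsPoleOrder.basis`). These classes form a subgroup
of `ℤ/m`, so the rank `d` divides `m`. The norm of `b` is `b(Q)^d` at `a = 0`, it divides a power
of `a - a(R)`, and its leading coefficient is governed by the value of `b^m / a^n` at `P`.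
Comparing the three facts gives reciprocity up to a `d`-th root of unity
(`IsPoleOrder.reciprocity`, `NonsingularCurve.weil_reciprocity`). For rational values only a sign
is left; it is decided by parity, using that `d ∣ m` if `m` or `n` is odd and that the value in
question is a square if both are even (`NonsingularCurve.value_mul_eq_neg_one_pow`). So the
symbols `S_i` have trivial tame symbols. No Riemann–Roch theorem or theory of degrees is needed.

**Triples.** A product of suitable powers of the three normalised functions of a triple has trivial
divisor, so it is a constant; by reciprocity it is a root of unity. Hence the `S_i` are
proportional modulo torsion, with the coprime weights `lcm(m₁, m₂, m₃) / m_i`, which gives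
existence and uniqueness of the triple symbol.

**Four points.** For a common multiple `D` of all orders choose `φ_j` with
`div φ_j = D (P_j) - D (P_3)` for `j = 0, 1, 2` and `(φ_j / φ_k)(P_3) = 1`. Reciprocity then says
`φ_j(P_k) = ± φ_k(P_j)`. All normalised functions are products of the `φ_j` and these constants
`κ_jk`, and bilinear expansion gives a cocycle relation up to terms `{κ, κ'}`, which vanish because
`K₂(ℚ)` is torsion (`IsSteinberg.rat_eq_zero`). The triple symbol differs from the symbol in this
relation by the factor `D² lcm / (m₁ m₂ m₃)`. Finally `gcd(m_ij, m_ik, m_il)` times the factor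
`m_jk m_jl m_kl / lcm(m_jk, m_jl, m_kl)` does not depend on `i` (`Nat.gcd_mul_div_lcm_eq`):
each `p`-adic valuation of the orders `m_ij` is an ultrametric on the four points, and the
identity says that both sides compute the length of a minimal spanning tree.
-/

/-! ### Constants and rational points -/

namespace NonsingularCurve

instance (C : NonsingularCurve) : CompactSpace C.X :=
  (quasiCompact_iff_compactSpace C.str).mp inferInstance

/-- A rational function which is regular at every closed point is a global section. -/
lemma exists_germ_eq_of_forall_closedPt (C : NonsingularCurve) (f : C.F)
    (h : ∀ x : C.ClosedPt, ∃ a : C.X.presheaf.stalk x.1,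
      algebraMap (C.X.presheaf.stalk x.1) C.F a = f) :
    ∃ s : Γ(C.X, ⊤), C.X.presheaf.germ ⊤ (genericPoint C.X) trivial s = f := by
  choose a ha using h
  have hg : ∀ x : C.ClosedPt, ∃ (U : C.X.Opens) (hx : x.1 ∈ U) (s : Γ(C.X, U)),
      C.X.presheaf.germ U x.1 hx s = a x := fun x => C.X.presheaf.exists_germ_eq (a x)
  choose U hU s hs using hg
  have hne : ∀ V : C.X.Opens, Nonempty V → genericPoint C.X ∈ V := fun V hV =>
    ((genericPoint_spec C.X).mem_open_set_iff V.isOpen).mpr (by simpa using hV)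
  have hgen : ∀ x, genericPoint C.X ∈ U x := fun x => hne _ ⟨⟨x.1, hU x⟩⟩
  have hsf : ∀ x, C.X.presheaf.germ (U x) (genericPoint C.X) (hgen x) (s x) = f := by
    intro x
    have : Nonempty (U x) := ⟨⟨x.1, hU x⟩⟩
    have h1 := Scheme.algebraMap_germ_eq_germToFunctionField C.X (hU x) (s x)
    rw [hs, ha] at h1
    exact h1.symm
  -- every non-empty closed subset of a quasi-compact scheme contains a closed point
  have hcover : (⊤ : C.X.Opens) ≤ iSup U := by
    intro y _
    by_contra hy
    obtain ⟨z, hz, hzc⟩ := (iSup U).isOpen.isClosed_compl.exists_closed_singleton ⟨y, hy⟩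
    exact hz (TopologicalSpace.Opens.mem_iSup.2 ⟨⟨z, hzc⟩, hU ⟨z, hzc⟩⟩)
  have hcompat : TopCat.Presheaf.IsCompatible C.X.sheaf.1 U s := by
    intro x y
    apply germ_injective_of_isIntegral (X := C.X) (genericPoint C.X) (U := U x ⊓ U y)
      ⟨hgen x, hgen y⟩
    have e1 := C.X.presheaf.germ_res_apply (TopologicalSpace.Opens.infLELeft (U x) (U y))
      (genericPoint C.X) ⟨hgen x, hgen y⟩ (s x)
    have e2 := C.X.presheaf.germ_res_apply (TopologicalSpace.Opens.infLERight (U x) (U y))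
      (genericPoint C.X) ⟨hgen x, hgen y⟩ (s y)
    exact (e1.trans (hsf x)).trans (e2.trans (hsf y)).symm
  obtain ⟨g, hg, -⟩ := C.X.sheaf.existsUnique_gluing' U ⊤ (fun x => homOfLE le_top) hcover s hcompat
  obtain ⟨z, -, hzc⟩ := (isClosed_univ (X := C.X)).exists_closed_singleton Set.univ_nonempty
  refine ⟨g, ?_⟩
  have e1 := C.X.presheaf.germ_res_apply (homOfLE le_top : U ⟨z, hzc⟩ ⟶ ⊤)
      (genericPoint C.X) (hgen ⟨z, hzc⟩) g
  rw [← hsf ⟨z, hzc⟩, ← hg ⟨z, hzc⟩]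
  exact e1.symm

/-- A rational function without poles is constant: the global sections form a field, which maps
to `ℚ` by evaluation at the rational point `P`. -/
lemma exists_const_eq_of_forall_closedPt {C : NonsingularCurve} (P : C.Point ℚ) (f : C.F)
    (h : ∀ x : C.ClosedPt, ∃ a : C.X.presheaf.stalk x.1,
      algebraMap (C.X.presheaf.stalk x.1) C.F a = f) :
    ∃ q : ℚ, C.const q = f := by
  obtain ⟨s, hs⟩ := C.exists_germ_eq_of_forall_closedPt f h
  let _ : Field Γ(C.X, ⊤) := (isField_of_universallyClosed ℚ C.str).toField
  let ρ : Γ(C.X, ⊤) →+* ℚ := (P.1.appTop ≫ (Scheme.ΓSpecIso (.of ℚ)).hom).hom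
  let ι : ℚ →+* Γ(C.X, ⊤) := ((Scheme.ΓSpecIso (.of ℚ)).inv ≫ C.str.appTop).hom
  refine ⟨ρ s, ?_⟩
  have h1 : ι (ρ s) = s := by
    apply ρ.injective
    exact RingHom.congr_fun (Subsingleton.elim (ρ.comp ι) (RingHom.id ℚ)) (ρ s)
  rw [← hs]
  conv_rhs => rw [← h1]
  rfl

/-- The constants lie in every local ring. -/
lemma exists_const_stalk (C : NonsingularCurve) (x : C.X) : ∃ ι : ℚ →+* C.X.presheaf.stalk x,
    ∀ q, algebraMap (C.X.presheaf.stalk x) C.F (ι q) = C.const q := by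
  refine ⟨((Scheme.ΓSpecIso (.of ℚ)).inv ≫ C.str.appTop ≫
    C.X.presheaf.germ ⊤ x trivial).hom, fun q => ?_⟩
  exact RingHom.congr_fun
    (Subsingleton.elim (RingHom.comp (algebraMap (C.X.presheaf.stalk x) C.F) _) C.const) q
/-- Two homomorphisms from a field of characteristic zero to `ℚ` agree. -/
lemma ringHom_rat_unique {κ : Type*} [Field κ] (ι : ℚ →+* κ) (φ ψ : κ →+* ℚ) : φ = ψ := by
  have h (χ : κ →+* ℚ) (q : ℚ) : χ (ι q) = q :=
    RingHom.congr_fun (Subsingleton.elim (χ.comp ι) (RingHom.id ℚ)) q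
  ext a
  have h1 : ι (φ a) = a := φ.injective (h φ _)
  rw [← h ψ (φ a), h1]

/-- A rational point is determined by the underlying point of the scheme. -/
lemma Point.pt_injective {C : NonsingularCurve} :
    Function.Injective (Point.pt : C.Point ℚ → C.X) := by
  intro P Q h
  apply Subtype.ext
  apply (Scheme.SpecToEquivOfField ℚ C.X).injective
  rw [Scheme.SpecToEquivOfField_eq_iff]
  refine ⟨h, ?_⟩
  obtain ⟨ι, -⟩ := C.exists_const_stalk P.pt
  apply CommRingCat.hom_ext
  exact ringHom_rat_unique ((C.X.residue P.pt).hom.comp ι) _ _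

lemma Point.closedPt_injective {C : NonsingularCurve} :
    Function.Injective (Point.closedPt : C.Point ℚ → C.ClosedPt) :=
  fun _ _ h => Point.pt_injective (congrArg Subtype.val h)

end NonsingularCurve

/-! ### Reciprocity for a domain with a pole order -/

section PoleOrder

open Polynomial WithZero

/-- A valuation `v` on a `k`-algebra `R` which behaves like the exponential of the pole order at
the point at infinity, for the ring of functions on a curve which are regular outside one rational
point. The last condition says that the graded pieces of the filtration by pole order have
dimension at most one. -/
structure IsPoleOrder (k : Type*) {R : Type*} [Field k] [CommRing R] [Algebra k R]
    (v : Valuation R ℤᵐ⁰) : Prop where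
  one_le : ∀ x, x ≠ 0 → 1 ≤ v x
  map_const : ∀ c : k, c ≠ 0 → v (algebraMap k R c) = 1
  exists_sub_lt : ∀ x y, x ≠ 0 → v x = v y → ∃ c : k, v (x - algebraMap k R c * y) < v x

/-- If the non-zero values of the summands are pairwise distinct, no summand can cancel. -/
lemma Valuation.le_map_sum_of_distinct {R Γ ι : Type*} [CommRing R]
    [LinearOrderedCommGroupWithZero Γ] [Fintype ι] (v : Valuation R Γ) (x : ι → R)
    (hx : ∀ i j, v (x i) = v (x j) → v (x i) ≠ 0 → i = j) (i : ι) : v (x i) ≤ v (∑ j, x j) := by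
  classical
  obtain ⟨j, -, hj⟩ := Finset.exists_max_image Finset.univ (fun j => v (x j)) ⟨i, Finset.mem_univ i⟩
  rcases eq_or_ne (v (x j)) 0 with h0 | h0
  · exact ((hj i (Finset.mem_univ i)).trans h0.le).trans zero_le
  · have hlt : v (∑ l ∈ Finset.univ.erase j, x l) < v (x j) := by
      apply v.map_sum_lt h0
      intro l hl
      refine lt_of_le_of_ne (hj l (Finset.mem_univ l)) fun h => ?_
      exact (Finset.ne_of_mem_erase hl) (hx j l h.symm h0).symm
    rw [← Finset.add_sum_erase _ _ (Finset.mem_univ j), v.map_add_eq_of_lt_left hlt]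
    exact hj i (Finset.mem_univ i)

namespace IsPoleOrder

variable {k R : Type*} [Field k] [CommRing R] [Algebra k R] {v : Valuation R ℤᵐ⁰}

lemma ne_zero (hv : IsPoleOrder k v) {x : R} (hx : x ≠ 0) : v x ≠ 0 :=
  (zero_lt_one.trans_le (hv.one_le x hx)).ne'

lemma log_nonneg (hv : IsPoleOrder k v) (x : R) : 0 ≤ log (v x) := by
  rcases eq_or_ne x 0 with rfl | hx
  · simp
  · rw [← log_one]
    exact (log_le_log one_ne_zero (hv.ne_zero hx)).2 (hv.one_le x hx)

lemma log_mul (hv : IsPoleOrder k v) {x y : R} (hx : x ≠ 0) (hy : y ≠ 0) :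
    log (v (x * y)) = log (v x) + log (v y) := by
  rw [map_mul, WithZero.log_mul (hv.ne_zero hx) (hv.ne_zero hy)]

variable [Nontrivial R] [NoZeroDivisors R] {m : ℕ} [NeZero m]

/-- The residue classes modulo `m` of the pole orders of non-zero elements. They are closed under
addition, hence form a subgroup of the finite group `ZMod m`. -/
def residues (hv : IsPoleOrder k v) (m : ℕ) [NeZero m] :
    AddSubgroup (ZMod m) where
  carrier := {r | ∃ x : R, x ≠ 0 ∧ ((log (v x) : ℤ) : ZMod m) = r}
  zero_mem' := ⟨1, one_ne_zero, by simp⟩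
  add_mem' := by
    rintro _ _ ⟨x, hx, rfl⟩ ⟨y, hy, rfl⟩
    exact ⟨x * y, mul_ne_zero hx hy, by rw [hv.log_mul hx hy]; push_cast; rfl⟩
  neg_mem' := by
    rintro _ ⟨x, hx, rfl⟩
    -- modulo `m`, the negative of a pole order is `m - 1` times it
    refine ⟨x ^ (m - 1), pow_ne_zero _ hx, ?_⟩
    rw [map_pow, log_pow]
    simp [Nat.cast_sub (NeZero.one_le (n := m))]

noncomputable instance (hv : IsPoleOrder k v) : Fintype (hv.residues m) := Fintype.ofFinite _

lemma exists_minimal (hv : IsPoleOrder k v) (r : hv.residues m) :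
    ∃ x : R, x ≠ 0 ∧ ((log (v x) : ℤ) : ZMod m) = r ∧
      ∀ y : R, y ≠ 0 → ((log (v y) : ℤ) : ZMod m) = r → log (v x) ≤ log (v y) := by
  obtain ⟨x, hx, hmin⟩ := WellFounded.has_min
    (InvImage.wf (fun x : R => (log (v x)).toNat) Nat.lt_wfRel.wf)
    {x : R | x ≠ 0 ∧ ((log (v x) : ℤ) : ZMod m) = r} r.2
  refine ⟨x, hx.1, hx.2, fun y hy hyr => ?_⟩
  have h1 := hmin y ⟨hy, hyr⟩
  have h2 := hv.log_nonneg x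
  have h3 := hv.log_nonneg y
  simp only [InvImage] at h1
  have h4 : ¬ (log (v y)).toNat < (log (v x)).toNat := h1
  omega

/-- An element of minimal pole order in each residue class. -/
noncomputable def gen (hv : IsPoleOrder k v) (r : hv.residues m) : R := (hv.exists_minimal r).choose

lemma gen_ne_zero (hv : IsPoleOrder k v) (r : hv.residues m) : hv.gen r ≠ 0 :=
  (hv.exists_minimal r).choose_spec.1

lemma log_gen (hv : IsPoleOrder k v) (r : hv.residues m) :
    ((log (v (hv.gen r)) : ℤ) : ZMod m) = r :=
  (hv.exists_minimal r).choose_spec.2.1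

lemma log_gen_le (hv : IsPoleOrder k v) (r : hv.residues m) {y : R} (hy : y ≠ 0)
    (hyr : ((log (v y) : ℤ) : ZMod m) = r) : log (v (hv.gen r)) ≤ log (v y) :=
  (hv.exists_minimal r).choose_spec.2.2 y hy hyr

variable [Algebra k[X] R] [IsScalarTower k k[X] R]

omit [Nontrivial R] [NoZeroDivisors R] in
lemma map_polynomial (hv : IsPoleOrder k v)
    (ha : v (algebraMap k[X] R X) = exp (m : ℤ)) (p : k[X]) (hp : p ≠ 0) :
    v (algebraMap k[X] R p) = exp ((m * p.natDegree : ℕ) : ℤ) := by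
  induction hn : p.natDegree using Nat.strong_induction_on generalizing p with
  | _ n ih =>
    have hlead : v (algebraMap k[X] R (C p.leadingCoeff * X ^ n)) = exp ((m * n : ℕ) : ℤ) := by
      rw [map_mul, map_pow, map_mul, map_pow, ha, ← Polynomial.algebraMap_eq,
        ← IsScalarTower.algebraMap_apply, hv.map_const _ (leadingCoeff_ne_zero.2 hp), one_mul,
        ← exp_nsmul]
      simp [mul_comm]
    have hdec : p = C p.leadingCoeff * X ^ n + p.eraseLead := by
      rw [← hn, add_comm, eraseLead_add_C_mul_X_pow]
    rw [hdec, map_add, ← hlead]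
    apply v.map_add_eq_of_lt_left
    rcases eq_or_ne p.eraseLead 0 with h0 | h0
    · rw [h0, map_zero, map_zero, hlead]
      exact exp_pos
    · have hlt : p.eraseLead.natDegree < n := by
        rw [← hn]
        exact (eraseLead_natDegree_lt_or_eraseLead_eq_zero p).resolve_right h0
      rw [ih _ hlt _ h0 rfl, hlead, exp_lt_exp]
      exact_mod_cast (Nat.mul_lt_mul_left (NeZero.pos m)).2 hlt

lemma map_mul_gen (hv : IsPoleOrder k v)
    (ha : v (algebraMap k[X] R X) = exp (m : ℤ)) {p : k[X]} (hp : p ≠ 0) (r : hv.residues m) :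
    v (p • hv.gen r) = exp (m * p.natDegree + log (v (hv.gen r))) := by
  rw [Algebra.smul_def, map_mul, hv.map_polynomial ha p hp, exp_add,
    exp_log (hv.ne_zero (hv.gen_ne_zero r))]
  push_cast
  rfl

/-- Different generators have pole orders in different classes modulo `m`, so there is no
cancellation in their `k[X]`-linear combinations. -/
lemma le_map_sum_gen (hv : IsPoleOrder k v)
    (ha : v (algebraMap k[X] R X) = exp (m : ℤ)) (p : hv.residues m → k[X]) (r : hv.residues m) :
    v (p r • hv.gen r) ≤ v (∑ s, p s • hv.gen s) := by
  refine v.le_map_sum_of_distinct (fun s => p s • hv.gen s) (fun i j hij h0 => ?_) r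
  have hi : p i ≠ 0 := by rintro h; simp [h] at h0
  have hj : p j ≠ 0 := by rintro h; rw [hij] at h0; simp [h] at h0
  rw [hv.map_mul_gen ha hi, hv.map_mul_gen ha hj, exp_inj] at hij
  have := congrArg (Int.cast : ℤ → ZMod m) hij
  push_cast at this
  rw [hv.log_gen, hv.log_gen] at this
  simpa using this

lemma linearIndependent_gen (hv : IsPoleOrder k v)
    (ha : v (algebraMap k[X] R X) = exp (m : ℤ)) :
    LinearIndependent k[X] (hv.gen : hv.residues m → R) := by
  rw [Fintype.linearIndependent_iff]
  intro p hp r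
  by_contra hr
  have h1 := hv.le_map_sum_gen ha p r
  rw [hp, map_zero, hv.map_mul_gen ha hr] at h1
  exact exp_ne_zero (le_zero_iff.1 h1)

/-- Subtracting a multiple `c X ^ q • gen r` lowers the pole order. -/
lemma span_gen (hv : IsPoleOrder k v)
    (ha : v (algebraMap k[X] R X) = exp (m : ℤ)) :
    ⊤ ≤ Submodule.span k[X] (Set.range (hv.gen : hv.residues m → R)) := by
  rintro x -
  induction hn : (log (v x)).toNat using Nat.strong_induction_on generalizing x with
  | _ n ih =>
    rcases eq_or_ne x 0 with rfl | hx
    · exact zero_mem _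
    let r : hv.residues m := ⟨((log (v x) : ℤ) : ZMod m), x, hx, rfl⟩
    have hle := hv.log_gen_le r hx rfl
    have hdvd : (m : ℤ) ∣ log (v x) - log (v (hv.gen r)) := by
      rw [← ZMod.intCast_zmod_eq_zero_iff_dvd]
      push_cast
      rw [hv.log_gen r, sub_self]
    obtain ⟨q, hq⟩ := hdvd
    have hq0 : 0 ≤ q := by
      have := NeZero.pos m
      by_contra hneg
      have : (m : ℤ) * q < 0 := mul_neg_of_pos_of_neg (by exact_mod_cast this) (by omega)
      omega
    lift q to ℕ using hq0
    have hvy : v x = v ((X ^ q : k[X]) • hv.gen r) := by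
      rw [hv.map_mul_gen ha (pow_ne_zero _ X_ne_zero), natDegree_X_pow, ← hq,
        sub_add_cancel, exp_log (hv.ne_zero hx)]
    obtain ⟨c, hc⟩ := hv.exists_sub_lt x _ hx hvy
    set z := x - algebraMap k R c * ((X ^ q : k[X]) • hv.gen r) with hz
    have hxz : x = z + (C c * X ^ q : k[X]) • hv.gen r := by
      rw [hz, mul_smul, Algebra.smul_def (C c), ← Polynomial.algebraMap_eq,
        ← IsScalarTower.algebraMap_apply]
      ring
    rw [hxz]
    refine add_mem ?_ (Submodule.smul_mem _ _ (Submodule.subset_span ⟨r, rfl⟩))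
    rcases eq_or_ne z 0 with h0 | h0
    · rw [h0]
      exact zero_mem _
    · refine ih (log (v z)).toNat ?_ rfl
      have h1 := (log_lt_log (hv.ne_zero h0) (hv.ne_zero hx)).2 hc
      have h2 := hv.log_nonneg z
      omega

/-- If `X` acts through an element of pole order `m`, then `R` is free over `k[X]`, with a basis
indexed by the classes modulo `m` of pole orders. -/
noncomputable def basis (hv : IsPoleOrder k v)
    (ha : v (algebraMap k[X] R X) = exp (m : ℤ)) : Module.Basis (hv.residues m) k[X] R :=
  Module.Basis.mk (hv.linearIndependent_gen ha) (hv.span_gen ha)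

lemma basis_apply (hv : IsPoleOrder k v)
    (ha : v (algebraMap k[X] R X) = exp (m : ℤ)) (r : hv.residues m) :
    hv.basis ha r = hv.gen r := by simp [basis]

/-- Weighted degree bound for the matrix of multiplication by `h`. -/
lemma leftMulMatrix_bound (hv : IsPoleOrder k v)
    (ha : v (algebraMap k[X] R X) = exp (m : ℤ)) {h : R} (s r : hv.residues m)
    (hne : Algebra.leftMulMatrix (hv.basis ha) h s r ≠ 0) :
    h ≠ 0 ∧ m * ((Algebra.leftMulMatrix (hv.basis ha) h s r).natDegree : ℤ) + log (v (hv.gen s)) ≤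
      log (v h) + log (v (hv.gen r)) := by
  have hh : h ≠ 0 := by rintro rfl; simp at hne
  refine ⟨hh, ?_⟩
  have h1 := hv.le_map_sum_gen ha (fun s => Algebra.leftMulMatrix (hv.basis ha) h s r) s
  have h2 : ∑ s, Algebra.leftMulMatrix (hv.basis ha) h s r • hv.gen s = h * hv.gen r := by
    have := (hv.basis ha).sum_repr (h * hv.basis ha r)
    simp only [basis_apply] at this
    rw [← this]
    simp [Algebra.leftMulMatrix_eq_repr_mul, basis_apply]
  rw [h2, hv.map_mul_gen ha hne] at h1
  rw [← hv.log_mul hh (hv.gen_ne_zero r), ← exp_le_exp,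
    exp_log (hv.ne_zero (mul_ne_zero hh (hv.gen_ne_zero r)))]
  exact h1

end IsPoleOrder

lemma Matrix.det_scalar_add_of_isNilpotent {n k : Type*} [Fintype n] [DecidableEq n] [Field k]
    (c : k) {N : Matrix n n k} (hN : IsNilpotent N) :
    (Matrix.scalar n c + N).det = c ^ Fintype.card n := by
  have h1 := Matrix.isNilpotent_charpoly_sub_pow_of_isNilpotent hN.neg
  have h2 : (-N).charpoly = X ^ Fintype.card n := sub_eq_zero.1 h1.eq_zero
  have h3 := Matrix.eval_charpoly (-N) c
  rw [h2, eval_pow, eval_X, sub_neg_eq_add] at h3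
  exact h3.symm

namespace IsPoleOrder

variable {k R : Type*} [Field k] [CommRing R] [Algebra k R] {v : Valuation R ℤᵐ⁰}
  [Nontrivial R] [NoZeroDivisors R] {m : ℕ} [NeZero m]
  [Algebra k[X] R] [IsScalarTower k k[X] R]

/-- If `h` equals `c a ^ t` up to lower pole order, where `X` acts as `a`, the diagonal entries of
the matrix of multiplication by `h` have leading term `c X ^ t`. -/
lemma leftMulMatrix_diag (hv : IsPoleOrder k v)
    (ha : v (algebraMap k[X] R X) = exp (m : ℤ)) {h : R} {t : ℕ} {c : k} (hc : c ≠ 0)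
    (hlt : v (h - algebraMap k[X] R (C c * X ^ t)) < exp ((m * t : ℕ) : ℤ)) (r : hv.residues m) :
    (Algebra.leftMulMatrix (hv.basis ha) h r r).natDegree = t ∧
      (Algebra.leftMulMatrix (hv.basis ha) h r r).leadingCoeff = c := by
  set l := h - algebraMap k[X] R (C c * X ^ t) with hl
  have h1 : Algebra.leftMulMatrix (hv.basis ha) h r r =
      C c * X ^ t + Algebra.leftMulMatrix (hv.basis ha) l r r := by
    have : h = algebraMap k[X] R (C c * X ^ t) + l := by rw [hl]; ring
    conv_lhs => rw [this]
    rw [map_add, AlgHom.commutes, Matrix.add_apply, Matrix.algebraMap_matrix_apply, if_pos rfl]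
    rfl
  have hdeg : (Algebra.leftMulMatrix (hv.basis ha) l r r).degree < (C c * X ^ t : k[X]).degree := by
    rw [degree_C_mul_X_pow t hc]
    rcases eq_or_ne (Algebra.leftMulMatrix (hv.basis ha) l r r) 0 with h0 | h0
    · rw [h0, degree_zero]
      exact WithBot.bot_lt_coe t
    · obtain ⟨hl0, hb⟩ := hv.leftMulMatrix_bound ha r r h0
      have h3 := (log_lt_log (hv.ne_zero hl0) exp_ne_zero).2 hlt
      rw [log_exp] at h3
      rw [degree_eq_natDegree h0]
      have h4 : (m : ℤ) * ((Algebra.leftMulMatrix (hv.basis ha) l r r).natDegree : ℤ) < m * t := by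
        push_cast at h3
        linarith
      have h5 := lt_of_mul_lt_mul_left h4 (by positivity)
      exact_mod_cast h5
  rw [h1]
  refine ⟨?_, ?_⟩
  · rw [natDegree_add_eq_left_of_degree_lt hdeg, natDegree_C_mul_X_pow t c hc]
  · rw [leadingCoeff_add_of_degree_lt' hdeg, leadingCoeff_C_mul_X_pow]

/-- If `h` equals `c a ^ t` up to lower pole order, the norm of `h` over `k[X]` has leading term
`(c X ^ t) ^ d`, where `d` is the rank: in the expansion of the determinant only the diagonal
reaches the maximal degree. -/
lemma norm_of_leading (hv : IsPoleOrder k v)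
    (ha : v (algebraMap k[X] R X) = exp (m : ℤ)) {h : R} {t : ℕ} {c : k} (hc : c ≠ 0)
    (hh : v h = exp ((m * t : ℕ) : ℤ))
    (hlt : v (h - algebraMap k[X] R (C c * X ^ t)) < exp ((m * t : ℕ) : ℤ)) :
    (Algebra.leftMulMatrix (hv.basis ha) h).det.natDegree = Fintype.card (hv.residues m) * t ∧
    (Algebra.leftMulMatrix (hv.basis ha) h).det.leadingCoeff =
      c ^ Fintype.card (hv.residues m) := by
  set M := Algebra.leftMulMatrix (hv.basis ha) h with hM
  set n := Fintype.card (hv.residues m) with hn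
  have hdiag := hv.leftMulMatrix_diag ha hc hlt
  have hdiag0 : ∀ r, M r r ≠ 0 := fun r => leadingCoeff_ne_zero.1 (by rw [(hdiag r).2]; exact hc)
  have hprod0 : ∏ r, M r r ≠ 0 := Finset.prod_ne_zero_iff.2 fun r _ => hdiag0 r
  have hprod : (∏ r, M r r).natDegree = n * t ∧ (∏ r, M r r).leadingCoeff = c ^ n := by
    rw [natDegree_prod _ _ fun r _ => hdiag0 r, leadingCoeff_prod]
    constructor
    · rw [Finset.sum_congr rfl fun r _ => (hdiag r).1]; simp [hn]
    · rw [Finset.prod_congr rfl fun r _ => (hdiag r).2]; simp [hn]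
  have hother : ∀ σ : Equiv.Perm (hv.residues m), σ ≠ 1 →
      (∏ r, M (σ r) r).degree < (∏ r, M r r).degree := by
    intro σ hσ
    rw [degree_eq_natDegree hprod0, hprod.1]
    rcases eq_or_ne (∏ r, M (σ r) r) 0 with h0 | h0
    · rw [h0, degree_zero]
      exact WithBot.bot_lt_coe _
    have h0' : ∀ r, M (σ r) r ≠ 0 := fun r => Finset.prod_ne_zero_iff.1 h0 r (Finset.mem_univ r)
    rw [degree_eq_natDegree h0, natDegree_prod _ _ fun r _ => h0' r]
    have hb : ∀ r, m * ((M (σ r) r).natDegree : ℤ) + log (v (hv.gen (σ r))) ≤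
        (m * t : ℕ) + log (v (hv.gen r)) := fun r => by
      have := (hv.leftMulMatrix_bound ha (σ r) r (h0' r)).2
      rwa [hh, log_exp] at this
    obtain ⟨r, hr⟩ : ∃ r, σ r ≠ r := by
      by_contra! hall
      exact hσ (Equiv.ext hall)
    have hs : ∑ r, (m * ((M (σ r) r).natDegree : ℤ) + log (v (hv.gen (σ r)))) <
        ∑ r : hv.residues m, (((m * t : ℕ) : ℤ) + log (v (hv.gen r))) := by
      refine Finset.sum_lt_sum (fun r _ => hb r) ⟨r, Finset.mem_univ r, lt_of_le_of_ne (hb r) ?_⟩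
      -- equality would force `r` and `σ r` to be the same class modulo `m`
      intro heq
      apply hr
      have := congrArg (Int.cast : ℤ → ZMod m) heq
      push_cast at this
      rw [hv.log_gen, hv.log_gen] at this
      simpa using this
    rw [Finset.sum_add_distrib, Finset.sum_add_distrib,
      Equiv.sum_comp σ (fun r => log (v (hv.gen r))), add_lt_add_iff_right, ← Finset.mul_sum] at hs
    simp only [Finset.sum_const, Finset.card_univ, nsmul_eq_mul] at hs
    have h5 : (m : ℤ) * ∑ r, ((M (σ r) r).natDegree : ℤ) < m * (n * t) := by
      push_cast at hs
      linarith
    have h6 := lt_of_mul_lt_mul_left h5 (by positivity)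
    exact_mod_cast h6
  have hdet : M.det = (∏ r, M r r) + ∑ σ ∈ Finset.univ.erase (1 : Equiv.Perm (hv.residues m)),
      Equiv.Perm.sign σ • ∏ r, M (σ r) r := by
    rw [Matrix.det_apply, ← Finset.add_sum_erase _ _ (Finset.mem_univ 1)]
    simp
  have hrest : (∑ σ ∈ Finset.univ.erase (1 : Equiv.Perm (hv.residues m)),
      Equiv.Perm.sign σ • ∏ r, M (σ r) r).degree < (∏ r, M r r).degree := by
    refine (degree_sum_le _ _).trans_lt ((Finset.sup_lt_iff ?_).2 ?_)
    · rw [degree_eq_natDegree hprod0]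
      exact WithBot.bot_lt_coe _
    · intro σ hσ
      refine lt_of_le_of_lt ?_ (hother σ (Finset.ne_of_mem_erase hσ))
      rcases Int.units_eq_one_or (Equiv.Perm.sign σ) with h | h <;> simp [h]
  rw [hdet]
  exact ⟨by rw [natDegree_add_eq_left_of_degree_lt hrest, hprod.1],
    by rw [leadingCoeff_add_of_degree_lt' hrest, hprod.2]⟩

/-- Let `X` act as `a`, of pole order `m`, and let `b` have pole order `m₂`. The divisibilities say
that `a` vanishes only where `b = b₂`, and `b` only where `a = a₁`; the constant `c` is the leading
coefficient of `b ^ m` with respect to `a ^ m₂`. The result compares the values at `0` and the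
leading terms of the norm of `b` over `k[X]`. -/
theorem reciprocity (hv : IsPoleOrder k v) {m₂ : ℕ}
    (ha : v (algebraMap k[X] R X) = exp (m : ℤ)) {b : R} (hb : v b = exp (m₂ : ℤ))
    {a₁ b₂ c : k} (hc : c ≠ 0)
    (ha₁ : b ∣ (algebraMap k[X] R (X - C a₁)) ^ m₂)
    (hb₂ : algebraMap k[X] R X ∣ (b - algebraMap k R b₂) ^ m)
    (hlt : v (b ^ m - algebraMap k[X] R (C c * X ^ m₂)) < exp ((m * m₂ : ℕ) : ℤ)) :
    ∃ n, n ∣ m ∧ (b₂ ^ m) ^ n = (c * (-a₁) ^ m₂) ^ n := by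
  set B := hv.basis ha with hB
  set M := Algebra.leftMulMatrix B b with hM
  set n := Fintype.card (hv.residues m) with hn
  have hnm : n ∣ m := by
    have := AddSubgroup.card_addSubgroup_dvd_card (hv.residues m)
    rwa [Nat.card_zmod, Nat.card_eq_fintype_card] at this
  -- the determinant of `b` modulo `X`
  have h0 : M.det.eval 0 = b₂ ^ n := by
    obtain ⟨r, hr⟩ := hb₂
    have e1 : M = Algebra.leftMulMatrix B (b - algebraMap k R b₂) +
        Matrix.scalar _ (C b₂) := by
      rw [map_sub, IsScalarTower.algebraMap_apply k k[X] R, AlgHom.commutes]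
      ext i j
      simp [hM, Matrix.algebraMap_eq_diagonal, Matrix.scalar_apply, Pi.algebraMap_def]
    set N := (Polynomial.evalRingHom (0 : k)).mapMatrix
      (Algebra.leftMulMatrix B (b - algebraMap k R b₂)) with hN
    -- modulo `a`, the operator `b - b₂` is nilpotent
    have hnil : IsNilpotent N := by
      refine ⟨m, ?_⟩
      rw [hN, ← map_pow, ← map_pow, hr, map_mul, AlgHom.commutes, map_mul]
      convert! zero_mul _
      ext i j
      simp [Matrix.algebraMap_matrix_apply]
      split_ifs <;> simp
    have e2 : (Polynomial.evalRingHom (0 : k)).mapMatrix M = Matrix.scalar _ b₂ + N := by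
      rw [e1, map_add, add_comm]
      congr 1
      ext i j
      simp [Matrix.scalar_apply, Matrix.diagonal_apply]
      split_ifs <;> simp
    have e3 := RingHom.map_det (Polynomial.evalRingHom (0 : k)) M
    rw [e2, Matrix.det_scalar_add_of_isNilpotent _ hnil] at e3
    simpa using e3
  -- `det b` divides a power of `X - a₁`
  obtain ⟨s, q, hq⟩ : ∃ (s : ℕ) (q : k), M.det = C q * (X - C a₁) ^ s := by
    obtain ⟨r, hr⟩ := ha₁
    have e1 : M.det ∣ (X - C a₁) ^ (m₂ * n) := by
      refine ⟨(Algebra.leftMulMatrix B r).det, ?_⟩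
      rw [← Matrix.det_mul, hM, ← map_mul, ← hr, ← map_pow, AlgHom.commutes, pow_mul]
      rw [Matrix.algebraMap_eq_diagonal, Matrix.det_diagonal]
      simp [hn]
    obtain ⟨s, -, hs⟩ := (dvd_prime_pow (prime_X_sub_C a₁) _).1 e1
    obtain ⟨u, hu⟩ := hs.symm
    obtain ⟨q, -, hq⟩ := Polynomial.isUnit_iff.1 u.isUnit
    exact ⟨s, q, by rw [← hu, ← hq, mul_comm]⟩
  -- the leading term of the norm of `b ^ m`
  have hlead := hv.norm_of_leading ha hc (h := b ^ m) (t := m₂)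
    (by rw [map_pow, hb, ← exp_nsmul]; simp) hlt
  rw [map_pow, Matrix.det_pow, ← hB, ← hM, hq, ← hn] at hlead
  have hq1 : q ^ m = c ^ n := by
    rw [← hlead.2]; simp
  have hs : s * m = n * m₂ := by
    rw [← hlead.1]
    have hq0 : q ≠ 0 := by
      rintro rfl
      rw [zero_pow (NeZero.ne m)] at hq1
      exact pow_ne_zero n hc hq1.symm
    rw [natDegree_pow, natDegree_C_mul hq0]
    simp [mul_comm]
  refine ⟨n, hnm, ?_⟩
  rw [hq] at h0
  simp only [eval_mul, eval_C, eval_pow, eval_sub, eval_X, zero_sub] at h0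
  rw [← pow_mul, mul_comm, pow_mul, ← h0, mul_pow, hq1, ← pow_mul, hs, mul_pow, mul_comm n,
    pow_mul]

end IsPoleOrder

end PoleOrder

/-! ### The identity between gcds and lcms -/

/-- In an ultrametric triangle the two longest sides agree; `x` is the sum of the shortest and
the longest side. -/
lemma Nat.ultrametric_triangle {u v w x : ℕ} (h1 : u ≤ max v w) (h2 : v ≤ max u w)
    (h3 : w ≤ max u v) (hx : x + max u (max v w) = u + (v + w)) :
    (v = u ∧ w ≤ u ∧ x = u + w) ∨ (w = u ∧ v ≤ u ∧ x = u + v) ∨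
      (w = v ∧ u ≤ v ∧ x = u + v) := by
  omega

/-- Four points in an ultrametric space: the distance from a point to the other three plus the
shortest and the longest side of the opposite triangle does not depend on the point. -/
lemma Nat.ultrametric_tetrahedron {a b c d e f x y : ℕ}
    (H1 : (b = a ∧ d ≤ a) ∨ (d = a ∧ b ≤ a) ∨ (d = b ∧ a ≤ b))
    (H2 : (c = a ∧ e ≤ a) ∨ (e = a ∧ c ≤ a) ∨ (e = c ∧ a ≤ c))
    (H3 : (c = b ∧ f ≤ b ∧ y = b + f) ∨ (f = b ∧ c ≤ b ∧ y = b + c) ∨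
      (f = c ∧ b ≤ c ∧ y = b + c))
    (H4 : (e = d ∧ f ≤ d ∧ x = d + f) ∨ (f = d ∧ e ≤ d ∧ x = d + e) ∨
      (f = e ∧ d ≤ e ∧ x = d + e)) :
    min a (min b c) + x = min a (min d e) + y := by
  rcases H1 with ⟨rfl, k1⟩ | ⟨rfl, k1⟩ | ⟨rfl, k1⟩ <;>
  rcases H2 with ⟨rfl, k2⟩ | ⟨rfl, k2⟩ | ⟨rfl, k2⟩ <;>
  rcases H3 with ⟨k3, k4, rfl⟩ | ⟨k3, k4, rfl⟩ | ⟨k3, k4, rfl⟩ <;> omega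

/-- Here `a, b, c, d, e, f` are the numbers attached to the edges `01, 02, 03, 12, 13, 23` of a
tetrahedron; the divisibilities say that their `p`-adic valuations are ultrametric on each face. -/
lemma Nat.gcd_mul_div_lcm_eq {a b c d e f : ℕ} (ha : 0 < a) (hb : 0 < b) (hc : 0 < c)
    (hd : 0 < d) (he : 0 < e) (hf : 0 < f)
    (h1 : a ∣ b.lcm d) (h2 : b ∣ a.lcm d) (h3 : d ∣ a.lcm b)
    (h4 : a ∣ c.lcm e) (h5 : c ∣ a.lcm e) (h6 : e ∣ a.lcm c)
    (h7 : b ∣ c.lcm f) (h8 : c ∣ b.lcm f) (h9 : f ∣ b.lcm c)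
    (h10 : d ∣ e.lcm f) (h11 : e ∣ d.lcm f) (h12 : f ∣ d.lcm e) {x y : ℕ}
    (hx : x * d.lcm (e.lcm f) = d * (e * f)) (hy : y * b.lcm (c.lcm f) = b * (c * f)) :
    a.gcd (b.gcd c) * x = a.gcd (d.gcd e) * y := by
  have hx0 : x ≠ 0 := by rintro rfl; simp at hx; omega
  have hy0 : y ≠ 0 := by rintro rfl; simp at hy; omega
  have hfac : ∀ {u v w : ℕ}, 0 < u → 0 < v → 0 < w → u ∣ v.lcm w → ∀ p,
      u.factorization p ≤ max (v.factorization p) (w.factorization p) := by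
    intro u v w hu hv hw h p
    have := (Nat.factorization_le_iff_dvd hu.ne' (Nat.lcm_ne_zero hv.ne' hw.ne')).2 h p
    rwa [Nat.factorization_lcm hv.ne' hw.ne'] at this
  have key : ∀ {u v w z : ℕ}, 0 < u → 0 < v → 0 < w → z ≠ 0 → z * u.lcm (v.lcm w) = u * (v * w) →
      ∀ p, z.factorization p +
        max (u.factorization p) (max (v.factorization p) (w.factorization p)) =
        u.factorization p + (v.factorization p + w.factorization p) := by
    intro u v w z hu hv hw hz h p
    have := congrArg (fun n => n.factorization p) h
    simpa [Nat.factorization_mul, Nat.factorization_lcm, hu.ne', hv.ne', hw.ne', hz,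
      Nat.lcm_ne_zero] using this
  apply Nat.eq_of_factorization_eq
  · exact mul_ne_zero (Nat.gcd_pos_of_pos_left _ ha).ne' hx0
  · exact mul_ne_zero (Nat.gcd_pos_of_pos_left _ ha).ne' hy0
  intro p
  rw [Nat.factorization_mul (Nat.gcd_pos_of_pos_left _ ha).ne' hx0,
    Nat.factorization_mul (Nat.gcd_pos_of_pos_left _ ha).ne' hy0,
    Nat.factorization_gcd ha.ne' (Nat.gcd_pos_of_pos_left _ hb).ne',
    Nat.factorization_gcd hb.ne' hc.ne',
    Nat.factorization_gcd ha.ne' (Nat.gcd_pos_of_pos_left _ hd).ne',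
    Nat.factorization_gcd hd.ne' he.ne']
  simp only [Finsupp.add_apply, Finsupp.inf_apply]
  have tri : ∀ {u v w : ℕ}, u ≤ max v w → v ≤ max u w → w ≤ max u v →
      (v = u ∧ w ≤ u) ∨ (w = u ∧ v ≤ u) ∨ (w = v ∧ u ≤ v) := by
    intros; omega
  exact Nat.ultrametric_tetrahedron
    (tri (hfac ha hb hd h1 p) (hfac hb ha hd h2 p) (hfac hd ha hb h3 p))
    (tri (hfac ha hc he h4 p) (hfac hc ha he h5 p) (hfac he ha hc h6 p))
    (Nat.ultrametric_triangle (hfac hb hc hf h7 p) (hfac hc hb hf h8 p) (hfac hf hb hc h9 p)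
      (key hb hc hf hy0 hy p))
    (Nat.ultrametric_triangle (hfac hd he hf h10 p) (hfac he hd hf h11 p) (hfac hf hd he h12 p)
      (key hd he hf hx0 hx p))

/-! ### Steinberg pairings and `K₂(ℚ)` -/

/-- The Steinberg relation for a bilinear pairing on the multiplicative group of a field. -/
def IsSteinberg {F W : Type*} [Field F] [AddCommGroup W]
    (B : Additive Fˣ →+ Additive Fˣ →+ W) : Prop :=
  ∀ a b : Fˣ, (a : F) + b = 1 → B (.ofMul a) (.ofMul b) = 0

namespace IsSteinberg

variable {F W : Type*} [Field F] [AddCommGroup W] [IsAddTorsionFree W]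
  {B : Additive Fˣ →+ Additive Fˣ →+ W}

omit [IsAddTorsionFree W] in
/-- This follows from `-a = (1 - a) / (1 - a⁻¹)`. -/
lemma map_neg_self (hB : IsSteinberg B) (a : Fˣ) : B (.ofMul a) (.ofMul (-a)) = 0 := by
  rcases eq_or_ne a 1 with rfl | ha
  · simp
  have h1 : (1 : F) - a ≠ 0 := fun h => ha (Units.ext (sub_eq_zero.1 h).symm)
  have h2 : (1 : F) - (a⁻¹ : Fˣ) ≠ 0 := fun h => ha (by
    have h3 : a⁻¹ = 1 := Units.ext (sub_eq_zero.1 h).symm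
    rwa [inv_eq_one] at h3)
  have e : -a = Units.mk0 _ h1 * (Units.mk0 _ h2)⁻¹ := by
    rw [eq_mul_inv_iff_mul_eq]
    ext
    simp
    field_simp
    ring
  have e1 := hB a (Units.mk0 _ h1) (by simp)
  have e2 := hB a⁻¹ (Units.mk0 _ h2) (by simp)
  rw [ofMul_inv, map_neg, AddMonoidHom.neg_apply, neg_eq_zero] at e2
  rw [e, ofMul_mul, ofMul_inv, map_add, map_neg, e1, e2]
  simp

lemma map_neg_one_right (B : Additive Fˣ →+ Additive Fˣ →+ W) (a : Additive Fˣ) :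
    B a (.ofMul (-1)) = 0 := by
  have h : (2 : ℕ) • B a (.ofMul (-1)) = 0 := by
    rw [← map_nsmul, ← ofMul_pow]
    simp
  exact (nsmul_eq_zero_iff_right two_ne_zero).1 h

lemma map_self (hB : IsSteinberg B) (a : Additive Fˣ) : B a a = 0 := by
  have h := hB.map_neg_self a.toMul
  have e : Additive.ofMul (-a.toMul) = Additive.ofMul (-1) + a := by
    rw [← neg_one_mul, ofMul_mul, ofMul_toMul]
  rwa [e, map_add, map_neg_one_right B, zero_add, ofMul_toMul] at h

lemma map_swap (hB : IsSteinberg B) (a b : Additive Fˣ) : B a b = -B b a := by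
  have h := hB.map_self (a + b)
  simp only [map_add, AddMonoidHom.add_apply, hB.map_self, zero_add, add_zero] at h
  exact eq_neg_of_add_eq_zero_right h

lemma map_neg_one_left (hB : IsSteinberg B) : B (.ofMul (-1)) = 0 := by
  refine AddMonoidHom.ext fun a => ?_
  rw [hB.map_swap, map_neg_one_right B, neg_zero]
  rfl

end IsSteinberg

section Rat

variable {W : Type*} [AddCommGroup W] [IsAddTorsionFree W]
  {B : Additive ℚˣ →+ Additive ℚˣ →+ W}

/-- The unit of `ℚ` attached to a positive natural number (and `1` for `0`). -/
def ratUnit (n : ℕ) : ℚˣ := if h : (n : ℚ) = 0 then 1 else Units.mk0 n h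

lemma val_ratUnit {n : ℕ} (hn : n ≠ 0) : (ratUnit n : ℚ) = n := by
  simp [ratUnit, hn]

lemma ratUnit_mul {m n : ℕ} (hm : m ≠ 0) (hn : n ≠ 0) :
    ratUnit (m * n) = ratUnit m * ratUnit n := by
  ext
  rw [Units.val_mul, val_ratUnit hm, val_ratUnit hn, val_ratUnit (mul_ne_zero hm hn)]
  push_cast
  rfl

omit [IsAddTorsionFree W] in
/-- If the pairing vanishes on positive integers below `p`, then pairing with `p` is
multiplicative modulo `p`: apply the Steinberg relation to `z / (x y) + k p / (x y) = 1`. -/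
lemma IsSteinberg.ratUnit_prime_mul (hB : IsSteinberg B) {p : ℕ}
    (ih : ∀ a b, 0 < a → a < p → 0 < b → b < p →
      B (.ofMul (ratUnit a)) (.ofMul (ratUnit b)) = 0)
    {x y z k : ℕ} (hx : 0 < x) (hxp : x < p) (hy : 0 < y) (hyp : y < p) (hz : 0 < z) (hzp : z < p)
    (hkp : k < p) (h : x * y = z + k * p) :
    B (.ofMul (ratUnit z)) (.ofMul (ratUnit p)) =
      B (.ofMul (ratUnit x)) (.ofMul (ratUnit p)) +
        B (.ofMul (ratUnit y)) (.ofMul (ratUnit p)) := by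
  rcases Nat.eq_zero_or_pos k with rfl | hk
  · rw [zero_mul, add_zero] at h
    rw [← h, ratUnit_mul hx.ne' hy.ne', ofMul_mul, map_add, AddMonoidHom.add_apply]
  · have hp : 0 < p := hx.trans hxp
    have h1 := hB (ratUnit z / (ratUnit x * ratUnit y)) (ratUnit k * ratUnit p /
        (ratUnit x * ratUnit y)) (by
      have hx' : (x : ℚ) ≠ 0 := by exact_mod_cast hx.ne'
      have hy' : (y : ℚ) ≠ 0 := by exact_mod_cast hy.ne'
      have h' : (x : ℚ) * y = z + k * p := by exact_mod_cast h
      push_cast [Units.val_div_eq_div_val]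
      rw [val_ratUnit hx.ne', val_ratUnit hy.ne', val_ratUnit hz.ne', val_ratUnit hk.ne',
        val_ratUnit hp.ne', ← add_div, ← h', div_self (mul_ne_zero hx' hy')])
    simp only [ofMul_div, ofMul_mul, map_sub, map_add, AddMonoidHom.add_apply,
      AddMonoidHom.sub_apply, ih z k hz hzp hk hkp, ih z x hz hzp hx hxp, ih z y hz hzp hy hyp,
      ih x k hx hxp hk hkp, ih y k hy hyp hk hkp, ih x x hx hxp hx hxp, ih x y hx hxp hy hyp,
      ih y x hy hyp hx hxp, ih y y hy hyp hy hyp] at h1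
    rw [← sub_eq_zero, ← h1]
    abel

/-- Tate's argument: by induction, pairing with a prime `N` is a homomorphism from the finite group
`(ℤ/N)ˣ` to a torsion-free group. -/
lemma IsSteinberg.ratUnit_eq_zero (hB : IsSteinberg B) (N : ℕ) : ∀ a b, 0 < a → a < N → 0 < b →
    b < N → B (.ofMul (ratUnit a)) (.ofMul (ratUnit b)) = 0 := by
  induction N with
  | zero => intro a b _ h; omega
  | succ N ih =>
    have key : ∀ x, 0 < x → x < N → B (.ofMul (ratUnit x)) (.ofMul (ratUnit N)) = 0 := by
      intro x hx hxN
      by_cases hp : N.Prime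
      · have : Fact N.Prime := ⟨hp⟩
        have hv : ∀ u : (ZMod N)ˣ, 0 < (u : ZMod N).val := fun u =>
          Nat.pos_of_ne_zero fun h => u.ne_zero ((ZMod.val_eq_zero _).1 h)
        let φ : Additive (ZMod N)ˣ →+ W := AddMonoidHom.mk'
          (fun u => B (.ofMul (ratUnit (u.toMul : ZMod N).val)) (.ofMul (ratUnit N)))
          (fun u w => by
            refine hB.ratUnit_prime_mul ih (hv u.toMul) (ZMod.val_lt _) (hv w.toMul)
              (ZMod.val_lt _) (hv (u + w).toMul) (ZMod.val_lt _)
              (k := (u.toMul : ZMod N).val * (w.toMul : ZMod N).val / N) ?_ ?_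
            · apply Nat.div_lt_of_lt_mul
              exact Nat.mul_lt_mul'' (ZMod.val_lt _) (ZMod.val_lt _)
            · rw [toMul_add, Units.val_mul, ZMod.val_mul, Nat.mod_add_div'])
        have hx0 : (x : ZMod N) ≠ 0 := by
          rw [Ne, ZMod.natCast_eq_zero_iff]
          exact Nat.not_dvd_of_pos_of_lt hx hxN
        have h1 : Fintype.card (Additive (ZMod N)ˣ) • φ (.ofMul (Units.mk0 _ hx0)) = 0 := by
          rw [← map_nsmul, card_nsmul_eq_zero, map_zero]
        have h2 := (nsmul_eq_zero_iff_right Fintype.card_ne_zero).1 h1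
        have h3 : ((x : ℕ) : ZMod N).val = x := ZMod.val_cast_of_lt hxN
        simpa [φ, h3] using h2
      · by_cases h1 : N = 1
        · omega
        obtain ⟨c, d, hc, hd, hcd⟩ := (Nat.not_prime_iff_exists_mul_eq (by omega)).1 hp
        have hc0 : 0 < c := Nat.pos_of_ne_zero (by rintro rfl; omega)
        have hd0 : 0 < d := Nat.pos_of_ne_zero (by rintro rfl; omega)
        rw [← hcd, ratUnit_mul hc0.ne' hd0.ne', ofMul_mul, map_add, ih x c hx hxN hc0 hc,
          ih x d hx hxN hd0 hd, add_zero]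
    intro a b ha haN hb hbN
    rcases Nat.lt_succ_iff_lt_or_eq.1 haN with h1 | rfl <;>
    rcases Nat.lt_succ_iff_lt_or_eq.1 hbN with h2 | rfl
    · exact ih a b ha h1 hb h2
    · exact key a ha h1
    · rw [hB.map_swap, key b hb h2, neg_zero]
    · exact hB.map_self _

/-- A Steinberg pairing on `ℚˣ` with torsion-free target vanishes; in other words, `K₂(ℚ)` is
torsion. -/
theorem IsSteinberg.rat_eq_zero (hB : IsSteinberg B) : B = 0 := by
  have h : ∀ q : ℚˣ, ∃ (ε : ℚˣ) (a b : ℕ), 0 < a ∧ 0 < b ∧ (ε = 1 ∨ ε = -1) ∧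
      q = ε * (ratUnit a / ratUnit b) := by
    intro q
    have hq : ((q : ℚ).num.natAbs : ℚ) ≠ 0 := by simp
    have hd : ((q : ℚ).den : ℚ) ≠ 0 := by simp
    have ha : (q : ℚ).num.natAbs ≠ 0 := by simp
    have hq2 : (q : ℚ) = (q : ℚ).num / (q : ℚ).den := (Rat.num_div_den _).symm
    rcases le_or_gt 0 (q : ℚ).num with h | h
    · refine ⟨1, _, _, Nat.pos_of_ne_zero ha, (q : ℚ).den_pos, Or.inl rfl, ?_⟩
      ext
      rw [Units.val_mul, Units.val_div_eq_div_val, val_ratUnit ha, val_ratUnit (q : ℚ).den_nz,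
        Nat.cast_natAbs, abs_of_nonneg h, ← hq2]
      simp
    · refine ⟨-1, _, _, Nat.pos_of_ne_zero ha, (q : ℚ).den_pos, Or.inr rfl, ?_⟩
      ext
      rw [Units.val_mul, Units.val_div_eq_div_val, val_ratUnit ha, val_ratUnit (q : ℚ).den_nz,
        Nat.cast_natAbs, abs_of_neg h]
      conv_lhs => rw [hq2]
      push_cast
      ring
  have hε : ∀ ε : ℚˣ, (ε = 1 ∨ ε = -1) → B (.ofMul ε) = 0 ∧ ∀ x, B x (.ofMul ε) = 0 := by
    rintro ε (rfl | rfl)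
    · simp
    · exact ⟨hB.map_neg_one_left, IsSteinberg.map_neg_one_right B⟩
  have hN : ∀ a b, 0 < a → 0 < b → B (.ofMul (ratUnit a)) (.ofMul (ratUnit b)) = 0 :=
    fun a b ha hb => hB.ratUnit_eq_zero (a + b + 1) a b ha (by omega) hb (by omega)
  refine AddMonoidHom.ext fun x => AddMonoidHom.ext fun y => ?_
  obtain ⟨ε, a, b, ha, hb, h1, hx⟩ := h x.toMul
  obtain ⟨η, c, d, hc, hd, h2, hy⟩ := h y.toMul
  have hx' : x = .ofMul (ε * (ratUnit a / ratUnit b)) := hx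
  have hy' : y = .ofMul (η * (ratUnit c / ratUnit d)) := hy
  rw [hx', hy']
  simp [(hε ε h1).1, (hε η h2).2, hN _ _ ha hc, hN _ _ hb hc, hN _ _ ha hd, hN _ _ hb hd]

end Rat

/-- The cocycle relation for four points. The `φ`'s stand for functions with a common pole and
`κⱼₖ` for the value of `φⱼ` at the `k`-th point; the arguments of `B` are normalised to have
value one there. -/
lemma cocycle_relation {G W : Type*} [AddCommGroup G] [AddCommGroup W] (B : G →+ G →+ W)
    (hself : ∀ x, B x x = 0) (φ₀ φ₁ φ₂ κ₀₁ κ₁₀ κ₀₂ κ₂₀ κ₁₂ κ₂₁ : G)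
    (h₀₁ : B κ₁₀ = B κ₀₁) (h₀₂ : B κ₂₀ = B κ₀₂) (h₁₂ : B κ₂₁ = B κ₁₂)
    (h1 : B κ₀₁ κ₀₂ = 0) (h2 : B κ₀₁ κ₁₂ = 0) (h3 : B κ₀₂ κ₁₂ = 0) :
    -B (φ₂ - κ₂₁) (-φ₁ + κ₁₂) + B (φ₂ - κ₂₀) (-φ₀ + κ₀₂) - B (φ₁ - κ₁₀) (-φ₀ + κ₀₁) +
      B (φ₁ - φ₂ - κ₁₀ + κ₂₀) (φ₂ - φ₀ - κ₂₁ + κ₀₁) = 0 := by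
  have hB : ∀ x y, B x y = -B y x := fun x y => by
    have h := hself (x + y)
    simp only [map_add, AddMonoidHom.add_apply, hself, zero_add, add_zero] at h
    exact eq_neg_of_add_eq_zero_right h
  have e : ∀ x, B x κ₂₁ = B x κ₁₂ := fun x => by rw [hB, h₁₂, ← hB]
  have h1' : B κ₀₂ κ₀₁ = 0 := by rw [hB, h1, neg_zero]
  simp only [map_add, map_sub, map_neg, AddMonoidHom.add_apply, AddMonoidHom.sub_apply,
    h₀₁, h₀₂, h₁₂, e, h2, h3, h1', hself, hB κ₀₁ φ₀, hB κ₀₁ φ₂, hB κ₀₂ φ₀, hB κ₀₂ φ₂,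
    hB κ₁₂ φ₁, hB φ₂ φ₁, hB φ₂ φ₀, hB φ₁ φ₀]
  abel

lemma IsSteinberg.comp_ringHom {E F W : Type*} [Field E] [Field F] [AddCommGroup W]
    {B : Additive Fˣ →+ Additive Fˣ →+ W} (hB : IsSteinberg B) (ι : E →+* F) :
    IsSteinberg ((B.comp (Units.map ι.toMonoidHom).toAdditive).compl₂
      (Units.map ι.toMonoidHom).toAdditive) := by
  intro a b hab
  refine hB (Units.map ι.toMonoidHom a) (Units.map ι.toMonoidHom b) ?_
  have h := congrArg ι hab
  rw [map_add, map_one] at h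
  exact h

lemma IsSteinberg.map_rat {F W : Type*} [Field F] [AddCommGroup W] [IsAddTorsionFree W]
    {B : Additive Fˣ →+ Additive Fˣ →+ W} (hB : IsSteinberg B) (ι : ℚ →+* F) (p q : ℚˣ) :
    B (.ofMul (Units.map ι.toMonoidHom p)) (.ofMul (Units.map ι.toMonoidHom q)) = 0 := by
  have h := (hB.comp_ringHom ι).rat_eq_zero
  exact DFunLike.congr_fun (DFunLike.congr_fun h (.ofMul p)) (.ofMul q)

/-! ### Orders and values of rational functions -/

section Valuations

open Polynomial WithZero

namespace NonsingularCurve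

variable {C : NonsingularCurve}

/-- The multiplicative valuation on the function field attached to a closed point. In contrast to
`ord` it is also defined at `0`. -/
noncomputable def val (x : C.ClosedPt) : Valuation C.F ℤᵐ⁰ :=
  (IsDiscreteValuationRing.maximalIdeal (C.X.presheaf.stalk x.1)).valuation C.F

lemma val_unit (x : C.ClosedPt) (f : C.Fˣ) : val x (f : C.F) = exp (-C.ord x f) := by
  have h : C.ord x f = -log (val x (f : C.F)) := rfl
  rw [h, neg_neg, exp_log]
  simp

lemma ord_eq_zero_iff (x : C.ClosedPt) (f : C.Fˣ) : C.ord x f = 0 ↔ val x (f : C.F) = 1 := by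
  rw [val_unit, ← exp_zero, exp_inj, neg_eq_zero]

lemma val_algebraMap_le_one (x : C.ClosedPt) (a : C.X.presheaf.stalk x.1) :
    val x (algebraMap _ C.F a) ≤ 1 :=
  IsDedekindDomain.HeightOneSpectrum.valuation_le_one _ _

lemma val_const (x : C.ClosedPt) {q : ℚ} (hq : q ≠ 0) : val x (C.const q) = 1 := by
  obtain ⟨ι, hι⟩ := C.exists_const_stalk x.1
  have h : ∀ r : ℚ, val x (C.const r) ≤ 1 := fun r => by
    rw [← hι]; exact val_algebraMap_le_one x _
  refine le_antisymm (h q) ?_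
  have h1 : val x (C.const q) * val x (C.const q⁻¹) = 1 := by
    rw [← map_mul, ← map_mul, mul_inv_cancel₀ hq, map_one, map_one]
  calc 1 = val x (C.const q) * val x (C.const q⁻¹) := h1.symm
    _ ≤ val x (C.const q) * 1 := by gcongr; exact h _
    _ = val x (C.const q) := mul_one _

lemma exists_const_of_val_le_one (P : C.Point ℚ) (f : C.F) (h : ∀ x : C.ClosedPt, val x f ≤ 1) :
    ∃ q : ℚ, C.const q = f :=
  exists_const_eq_of_forall_closedPt P f fun x =>
    IsDiscreteValuationRing.exists_lift_of_le_one (h x)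

/-- A non-zero constant as a unit of the function field. -/
noncomputable abbrev constUnit (C : NonsingularCurve) : ℚˣ →* C.Fˣ := Units.map C.const.toMonoidHom

lemma ord_constUnit (x : C.ClosedPt) (q : ℚˣ) : C.ord x (constUnit C q) = 0 := by
  rw [ord_eq_zero_iff]
  exact val_const x q.ne_zero

namespace Point

lemma val_lt_one_of_eval_eq_zero (P : C.Point ℚ) {a : C.X.presheaf.stalk P.closedPt.1}
    (ha : P.eval a = 0) : val P.closedPt (algebraMap _ C.F a) < 1 := by
  refine (IsDedekindDomain.HeightOneSpectrum.valuation_lt_one_iff_mem _ _).2 ?_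
  change a ∈ IsLocalRing.maximalIdeal _
  rw [IsLocalRing.mem_maximalIdeal, mem_nonunits_iff]
  intro hu
  exact (hu.map P.eval).ne_zero ha

lemma val_sub_value_lt (P : C.Point ℚ) {f : C.Fˣ} (hf : C.ord P.closedPt f = 0) :
    val P.closedPt ((f : C.F) - C.const (P.value f : ℚ)) < 1 := by
  obtain ⟨ι, hι⟩ := C.exists_const_stalk P.closedPt.1
  obtain ⟨a, rfl⟩ := TameSymbol.exists_unit_of_ord_eq_zero (C.X.presheaf.stalk P.closedPt.1) hf
  have hv : P.value (Units.map (algebraMap (C.X.presheaf.stalk P.closedPt.1) C.F).toMonoidHom a) =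
    Units.map P.eval.toMonoidHom a := TameSymbol.value_map _ _
  rw [hv, ← hι]
  have e : ((Units.map (algebraMap (C.X.presheaf.stalk P.closedPt.1) C.F).toMonoidHom a : C.Fˣ) :
      C.F) = algebraMap _ C.F (a : C.X.presheaf.stalk P.closedPt.1) := rfl
  rw [e, ← map_sub]
  apply P.val_lt_one_of_eval_eq_zero
  have h2 : ∀ q, P.eval (ι q) = q := fun q =>
    RingHom.congr_fun (Subsingleton.elim (P.eval.comp ι) (RingHom.id ℚ)) q
  rw [map_sub, h2]
  exact sub_self _

lemma value_eq_of_val_lt (P : C.Point ℚ) {f : C.Fˣ} (hf : C.ord P.closedPt f = 0) {q : ℚ}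
    (h : val P.closedPt ((f : C.F) - C.const q) < 1) : (P.value f : ℚ) = q := by
  by_contra hne
  have h1 := P.val_sub_value_lt hf
  have h2 := val_const P.closedPt (sub_ne_zero.2 hne)
  have h3 : C.const ((P.value f : ℚ) - q) = ((f : C.F) - C.const q) -
      ((f : C.F) - C.const (P.value f : ℚ)) := by rw [map_sub]; ring
  rw [h3] at h2
  exact absurd h2 (((val P.closedPt).map_sub _ _).trans_lt (max_lt h h1)).ne

lemma value_constUnit (P : C.Point ℚ) (q : ℚˣ) : P.value (constUnit C q) = q := by
  ext
  apply P.value_eq_of_val_lt (ord_constUnit _ _)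
  simp

lemma value_mul (P : C.Point ℚ) {f g : C.Fˣ} (hf : C.ord P.closedPt f = 0)
    (hg : C.ord P.closedPt g = 0) : P.value (f * g) = P.value f * P.value g :=
  TameSymbol.value_mul _ hf hg

lemma value_zpow (P : C.Point ℚ) {f : C.Fˣ} (hf : C.ord P.closedPt f = 0) (n : ℤ) :
    P.value (f ^ n) = P.value f ^ n :=
  TameSymbol.value_zpow _ hf n

lemma value_pow (P : C.Point ℚ) {f : C.Fˣ} (hf : C.ord P.closedPt f = 0) (n : ℕ) :
    P.value (f ^ n) = P.value f ^ n := by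
  simpa using P.value_zpow hf n

lemma value_inv (P : C.Point ℚ) {f : C.Fˣ} (hf : C.ord P.closedPt f = 0) :
    P.value f⁻¹ = (P.value f)⁻¹ := by
  simpa using P.value_zpow hf (-1)

lemma value_div (P : C.Point ℚ) {f g : C.Fˣ} (hf : C.ord P.closedPt f = 0)
    (hg : C.ord P.closedPt g = 0) : P.value (f / g) = P.value f / P.value g := by
  rw [div_eq_mul_inv, P.value_mul hf, P.value_inv hg, div_eq_mul_inv]
  rw [ord, TameSymbol.ord_inv]
  exact neg_eq_zero.2 hg

end Point

lemma ord_mul (x : C.ClosedPt) (f g : C.Fˣ) : C.ord x (f * g) = C.ord x f + C.ord x g :=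
  TameSymbol.ord_mul _ f g

lemma ord_inv (x : C.ClosedPt) (f : C.Fˣ) : C.ord x f⁻¹ = -C.ord x f := TameSymbol.ord_inv _ f

lemma ord_div (x : C.ClosedPt) (f g : C.Fˣ) : C.ord x (f / g) = C.ord x f - C.ord x g := by
  rw [div_eq_mul_inv, ord_mul, ord_inv, sub_eq_add_neg]

lemma ord_zpow (x : C.ClosedPt) (f : C.Fˣ) (n : ℤ) : C.ord x (f ^ n) = n * C.ord x f :=
  TameSymbol.ord_zpow _ f n

lemma ord_pow (x : C.ClosedPt) (f : C.Fˣ) (n : ℕ) : C.ord x (f ^ n) = n * C.ord x f := by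
  simpa using ord_zpow x f n

lemma ord_normalize (x : C.ClosedPt) (f : C.Fˣ) (P : C.Point ℚ) :
    C.ord x (normalize f P) = C.ord x f := by
  rw [normalize, ord_div, ord_constUnit, sub_zero]

lemma value_normalize {f : C.Fˣ} {P : C.Point ℚ} (hf : C.ord P.closedPt f = 0) :
    P.value (normalize f P) = 1 := by
  rw [normalize, P.value_div hf (ord_constUnit _ _), P.value_constUnit, div_self']

/-- Two functions with the same divisor and the same value at one point agree. -/
lemma eq_of_ord_eq {f g : C.Fˣ} {P : C.Point ℚ} (h : ∀ x, C.ord x f = C.ord x g)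
    (hf : C.ord P.closedPt f = 0) (hv : P.value f = P.value g) : f = g := by
  have hfg : ∀ x, C.ord x (f / g) = 0 := fun x => by rw [ord_div, h, sub_self]
  obtain ⟨q, hq⟩ := exists_const_of_val_le_one P ((f / g : C.Fˣ) : C.F) fun x =>
    ((ord_eq_zero_iff x _).1 (hfg x)).le
  have h1 : (P.value (f / g) : ℚ) = q := by
    apply P.value_eq_of_val_lt (hfg _)
    rw [hq]; simp
  rw [P.value_div hf (by rw [← h, hf]), hv, div_self'] at h1
  have h2 : f / g = 1 := by
    ext
    rw [← hq, ← h1]; simp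
  exact div_eq_one.1 h2

lemma smul_diff_apply (m : ℕ) (P Q : C.Point ℚ) (x : C.ClosedPt) [DecidableEq C.ClosedPt] :
    (m • diff P Q) x =
      m * ((if P.closedPt = x then 1 else 0) - if Q.closedPt = x then 1 else 0) := by
  simp [diff, Finsupp.single_apply]

namespace HasDivisor

variable {f : C.Fˣ} {m : ℕ} {P Q : C.Point ℚ}

lemma ord_left (h : C.HasDivisor f (m • diff P Q)) (hPQ : P ≠ Q) : C.ord P.closedPt f = m := by
  classical
  rw [h, smul_diff_apply, if_pos rfl, if_neg (Point.closedPt_injective.ne hPQ.symm)]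
  simp

lemma ord_right (h : C.HasDivisor f (m • diff P Q)) (hPQ : P ≠ Q) : C.ord Q.closedPt f = -m := by
  classical
  rw [h, smul_diff_apply, if_pos rfl, if_neg (Point.closedPt_injective.ne hPQ)]
  simp

lemma ord_of_ne (h : C.HasDivisor f (m • diff P Q)) {x : C.ClosedPt} (hP : x ≠ P.closedPt)
    (hQ : x ≠ Q.closedPt) : C.ord x f = 0 := by
  classical
  rw [h, smul_diff_apply, if_neg hP.symm, if_neg hQ.symm]
  simp

lemma ord_other (h : C.HasDivisor f (m • diff P Q)) {R : C.Point ℚ} (hP : R ≠ P)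
    (hQ : R ≠ Q) : C.ord R.closedPt f = 0 :=
  h.ord_of_ne (Point.closedPt_injective.ne hP) (Point.closedPt_injective.ne hQ)

lemma inv (h : C.HasDivisor f (m • diff P Q)) : C.HasDivisor f⁻¹ (m • diff Q P) := by
  classical
  intro x
  rw [ord_inv, h, smul_diff_apply, smul_diff_apply]
  ring

lemma pow (h : C.HasDivisor f (m • diff P Q)) (n : ℕ) :
    C.HasDivisor (f ^ n) ((n * m) • diff P Q) := by
  intro x
  rw [ord_pow, h, mul_smul, Finsupp.smul_apply n, nsmul_eq_mul]

lemma mul {R : C.Point ℚ} (h : C.HasDivisor f (m • diff P Q)) {g : C.Fˣ}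
    (hg : C.HasDivisor g (m • diff Q R)) : C.HasDivisor (f * g) (m • diff P R) := by
  intro x
  rw [ord_mul, h, hg, ← Finsupp.add_apply, ← smul_add]
  simp [diff]

lemma normalize (h : C.HasDivisor f (m • diff P Q)) (R : C.Point ℚ) :
    C.HasDivisor (normalize f R) (m • diff P Q) := fun x => by rw [ord_normalize, h]

end HasDivisor

/-! ### Weil reciprocity -/

/-- The ring of functions which are regular outside a given rational point. -/
noncomputable def regularAway (P : C.Point ℚ) : Subring C.F where
  carrier := {f | ∀ x, x ≠ P.closedPt → val x f ≤ 1}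
  mul_mem' := fun {a b} ha hb x hx => by
    rw [map_mul]; exact mul_le_one' (ha x hx) (hb x hx)
  one_mem' := fun x _ => by rw [map_one]
  add_mem' := fun {a b} ha hb x hx => ((val x).map_add a b).trans (max_le (ha x hx) (hb x hx))
  zero_mem' := fun x _ => by rw [map_zero]; exact zero_le
  neg_mem' := fun {a} ha x hx => by rw [Valuation.map_neg]; exact ha x hx

noncomputable instance (P : C.Point ℚ) : Algebra ℚ (regularAway P) :=
  (C.const.codRestrict (regularAway P) fun q x _ => by
    rcases eq_or_ne q 0 with rfl | hq
    · rw [map_zero, map_zero]; exact zero_le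
    · exact (val_const x hq).le).toAlgebra

/-- At a rational point the residue field is `ℚ`, so the graded pieces have dimension at most one;
a regular function vanishing at `P` has no poles at all and is therefore zero. -/
lemma isPoleOrder_regularAway (P : C.Point ℚ) :
    IsPoleOrder ℚ ((val P.closedPt).comap (regularAway P).subtype) where
  one_le := fun x hx => by
    by_contra! hlt
    obtain ⟨q, hq⟩ := exists_const_of_val_le_one P (x : C.F) fun y => by
      rcases eq_or_ne y P.closedPt with rfl | hy
      · exact hlt.le
      · exact x.2 y hy
    have hq0 : q ≠ 0 := by
      rintro rfl
      rw [map_zero] at hq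
      exact hx (Subtype.ext hq.symm)
    have h1 := val_const P.closedPt hq0
    rw [hq] at h1
    exact hlt.ne h1
  map_const := fun c hc => val_const P.closedPt hc
  exists_sub_lt := fun x y hx hxy => by
    have hxy : val P.closedPt (x : C.F) = val P.closedPt (y : C.F) := hxy
    have hx' : (x : C.F) ≠ 0 := fun h => hx (Subtype.ext h)
    have hvx : val P.closedPt (x : C.F) ≠ 0 := (Valuation.ne_zero_iff _).2 hx'
    have hy' : (y : C.F) ≠ 0 := (Valuation.ne_zero_iff _).1 (hxy ▸ hvx)
    let f : C.Fˣ := Units.mk0 _ (div_ne_zero hx' hy')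
    have hf : C.ord P.closedPt f = 0 := by
      rw [ord_eq_zero_iff, Units.val_mk0, map_div₀, ← hxy, div_self hvx]
    refine ⟨P.value f, ?_⟩
    change val P.closedPt ((x : C.F) - C.const (P.value f : ℚ) * y) < val P.closedPt (x : C.F)
    have h1 : (x : C.F) - C.const (P.value f : ℚ) * y =
        ((f : C.F) - C.const (P.value f : ℚ)) * y := by
      rw [sub_mul, Units.val_mk0, div_mul_cancel₀ _ hy']
    rw [h1, map_mul, ← hxy]
    calc _ < 1 * val P.closedPt (x : C.F) := by
          rw [mul_lt_mul_iff_left₀ (zero_lt_iff.2 hvx)]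
          exact P.val_sub_value_lt hf
      _ = _ := one_mul _

/-- If `g` vanishes only at `R`, to order `m`, it divides `h ^ m` for every `h` vanishing
at `R`. -/
lemma dvd_regularAway {P R : C.Point ℚ} {g : C.Fˣ} {m : ℕ}
    (hRP : R ≠ P) (hg : C.HasDivisor g (m • diff R P))
    {h g' : regularAway P} (hgg : (g' : C.F) = g) (hlt : val R.closedPt (h : C.F) < 1) :
    g' ∣ h ^ m := by
  have hval : ∀ x, x ≠ P.closedPt → val x ((h : C.F) ^ m / g) ≤ 1 := by
    intro x hx
    rw [map_div₀, map_pow, val_unit]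
    rcases eq_or_ne x R.closedPt with rfl | hxR
    · rw [hg.ord_left hRP]
      have h1 : val R.closedPt (h : C.F) ≤ exp (-1) := by
        rcases eq_or_ne (val R.closedPt (h : C.F)) 0 with h0 | h0
        · rw [h0]; exact zero_le
        · rw [← exp_log h0] at hlt ⊢
          rw [← exp_zero, exp_lt_exp] at hlt
          rw [exp_le_exp]
          omega
      rw [div_le_one₀ exp_pos]
      calc _ ≤ exp (-1 : ℤ) ^ m := pow_le_pow_left' h1 m
        _ = _ := by rw [← exp_nsmul]; simp
    · rw [hg.ord_of_ne hxR hx, neg_zero, exp_zero, div_one]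
      exact pow_le_one' (h.2 x hx) m
  refine ⟨⟨(h : C.F) ^ m / g, hval⟩, Subtype.ext ?_⟩
  change (h : C.F) ^ m = g' * ((h : C.F) ^ m / g)
  rw [hgg, mul_div_cancel₀]
  exact g.ne_zero

/-- Weil reciprocity, up to a root of unity, for two functions with a common pole `P` and zeros at
`Q` and `R` respectively. -/
theorem weil_reciprocity {P Q R : C.Point ℚ} (hQP : Q ≠ P) (hRP : R ≠ P) (hQR : Q ≠ R)
    {a b : C.Fˣ} {m n : ℕ} (hm : 0 < m) (ha : C.HasDivisor a (m • diff Q P))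
    (hb : C.HasDivisor b (n • diff R P)) :
    ∃ d, d ∣ m ∧ ((Q.value b : ℚ) ^ m) ^ d =
      (P.value (b ^ m / a ^ n) * (-(R.value a : ℚ)) ^ n) ^ d := by
  have : NeZero m := ⟨hm.ne'⟩
  have hmem : ∀ {f : C.Fˣ} {k : ℕ} {T : C.Point ℚ}, C.HasDivisor f (k • diff T P) → T ≠ P →
      (f : C.F) ∈ regularAway P := by
    intro f k T h hT x hx
    rw [val_unit, ← exp_zero, exp_le_exp]
    rcases eq_or_ne x T.closedPt with rfl | hxT
    · rw [h.ord_left hT]; omega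
    · rw [h.ord_of_ne hxT hx]; omega
  let a' : regularAway P := ⟨a, hmem ha hQP⟩
  let b' : regularAway P := ⟨b, hmem hb hRP⟩
  -- `X` acts as multiplication by `a`
  let _ : Algebra ℚ[X] (regularAway P) := (aeval (R := ℚ) a').toAlgebra
  have hmap : ∀ p : ℚ[X], algebraMap ℚ[X] (regularAway P) p = aeval a' p := fun _ => rfl
  have : IsScalarTower ℚ ℚ[X] (regularAway P) := IsScalarTower.of_algebraMap_eq fun q => by
    rw [hmap, Polynomial.algebraMap_eq, aeval_C]
  have hord : C.ord P.closedPt (b ^ m / a ^ n) = 0 := by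
    rw [ord_div, ord_pow, ord_pow, ha.ord_right hQP, hb.ord_right hRP]
    ring
  refine (isPoleOrder_regularAway P).reciprocity (m := m) (m₂ := n) (b := b') (a₁ := R.value a)
    (b₂ := Q.value b) (c := P.value (b ^ m / a ^ n)) ?_ ?_ (Units.ne_zero _) ?_ ?_ ?_
  · rw [hmap, aeval_X]
    change val P.closedPt (a : C.F) = _
    rw [val_unit, ha.ord_right hQP, neg_neg]
  · change val P.closedPt (b : C.F) = _
    rw [val_unit, hb.ord_right hRP, neg_neg]
  · apply dvd_regularAway hRP hb rfl
    rw [hmap, map_sub, aeval_X, aeval_C]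
    exact R.val_sub_value_lt (ha.ord_other hQR.symm hRP)
  · apply dvd_regularAway hQP ha (by rw [hmap, aeval_X])
    exact Q.val_sub_value_lt (hb.ord_other hQR hQP)
  · rw [hmap, map_mul, aeval_C, map_pow, aeval_X]
    change val P.closedPt
      ((b : C.F) ^ m - C.const (P.value (b ^ m / a ^ n) : ℚ) * (a : C.F) ^ n) < _
    have h1 : (b : C.F) ^ m - C.const (P.value (b ^ m / a ^ n) : ℚ) * (a : C.F) ^ n =
        (((b ^ m / a ^ n : C.Fˣ) : C.F) - C.const (P.value (b ^ m / a ^ n) : ℚ)) *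
          (a ^ n : C.Fˣ) := by
      rw [sub_mul, ← Units.val_mul, div_mul_cancel]
      push_cast
      rfl
    have h2 := P.val_sub_value_lt hord
    have h3 : val P.closedPt ((a ^ n : C.Fˣ) : C.F) = exp ((m * n : ℕ) : ℤ) := by
      rw [val_unit, ord_pow, ha.ord_right hQP]
      congr 1
      push_cast
      ring
    rw [h1, map_mul, h3]
    calc _ < 1 * exp ((m * n : ℕ) : ℤ) := by
          rw [mul_lt_mul_iff_left₀ exp_pos]
          exact h2
      _ = _ := one_mul _

end NonsingularCurve

end Valuations

/-! ### Tame symbols of the normalised functions -/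

namespace NonsingularCurve

variable {C : NonsingularCurve}

/-- Weil reciprocity with the exact sign, for functions of value one at the third point. If one of
the multiplicities is odd, the exponent in `weil_reciprocity` is odd and can be cancelled; if both
are even, the left-hand side is a square and therefore positive. -/
theorem value_mul_eq_neg_one_pow {P Q R : C.Point ℚ} (hQP : Q ≠ P) (hRP : R ≠ P) (hQR : Q ≠ R)
    {a g : C.Fˣ} {m n : ℕ} (hm : 0 < m) (hn : 0 < n) (ha : C.HasDivisor a (m • diff Q P))
    (hg : C.HasDivisor g (n • diff P R)) (haR : R.value a = 1) (hgQ : Q.value g = 1) :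
    P.value (a ^ n * g ^ m) = (-1) ^ (m * n) := by
  have hb : C.HasDivisor g⁻¹ (n • diff R P) := hg.inv
  have hbQ : Q.value g⁻¹ = 1 := by rw [Q.value_inv (hg.ord_other hQP hQR), hgQ, inv_one]
  have hord : C.ord P.closedPt (a ^ n * g ^ m) = 0 := by
    rw [ord_mul, ord_pow, ord_pow, ha.ord_right hQP, hg.ord_left hRP.symm]
    ring
  set w := P.value (a ^ n * g ^ m) with hw
  obtain ⟨d, hdm, hd⟩ := weil_reciprocity hQP hRP hQR hm ha hb
  obtain ⟨d', hdn, hd'⟩ := weil_reciprocity hRP hQP hQR.symm hn hb ha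
  have e1 : g⁻¹ ^ m / a ^ n = (a ^ n * g ^ m)⁻¹ := by
    rw [inv_pow, mul_inv, div_eq_mul_inv, mul_comm]
  have e2 : a ^ n / g⁻¹ ^ m = a ^ n * g ^ m := by rw [inv_pow, div_inv_eq_mul]
  rw [e1, P.value_inv hord, hbQ, haR, ← hw] at hd
  rw [e2, hbQ, haR, ← hw] at hd'
  simp only [Units.val_one, one_pow, Units.val_inv_eq_inv_val] at hd hd'
  have hd0 : d ≠ 0 := by rintro rfl; rw [zero_dvd_iff] at hdm; omega
  rcases Nat.even_or_odd m with hme | hmo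
  · rcases Nat.even_or_odd n with hne | hno
    · obtain ⟨m', rfl⟩ := hme
      obtain ⟨n', rfl⟩ := hne
      have hsq : w = P.value (a ^ n' * g ^ m') ^ 2 := by
        have hord' : C.ord P.closedPt (a ^ n' * g ^ m') = 0 := by
          rw [← two_mul, ← two_mul, mul_comm 2, mul_comm 2, pow_mul, pow_mul, ← mul_pow,
            ord_pow] at hord
          simpa using hord
        rw [hw, ← P.value_pow hord', mul_pow, ← pow_mul, ← pow_mul, mul_two, mul_two]
      have hpos : 0 < (w : ℚ) := by
        rw [hsq]
        push_cast
        have := (P.value (a ^ n' * g ^ m')).ne_zero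
        positivity
      have hev : Even (n' + n') := ⟨n', rfl⟩
      rw [hev.neg_one_pow, mul_one] at hd
      have h1 := (pow_eq_one_iff_of_nonneg (inv_nonneg.2 hpos.le) hd0).1 hd.symm
      rw [(hev.mul_left _).neg_one_pow]
      ext
      simpa using h1
    · have hdo : Odd d' := Odd.of_dvd_nat hno hdn
      have h1 : (w : ℚ) * (-1) ^ m = 1 := by
        apply hdo.strictMono_pow.injective
        simpa using hd'.symm
      rw [hme.neg_one_pow, mul_one] at h1
      rw [(hme.mul_right _).neg_one_pow]
      ext
      simpa using h1
  · have hdo : Odd d := Odd.of_dvd_nat hmo hdm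
    have h1 : (w : ℚ)⁻¹ * (-1) ^ n = 1 := by
      apply hdo.strictMono_pow.injective
      simpa using hd.symm
    rw [inv_mul_eq_one₀ w.ne_zero] at h1
    rw [pow_mul, hmo.neg_one_pow]
    ext
    simpa using h1

/-- The tame symbol at a point over a rational point is the image of the rational tame symbol. The
equality `x = y` of closed points is kept apart from the evaluations to avoid transports between
local rings. -/
lemma tame_eq_map_of_eq {L : Type} [Field L] [Algebra ℚ L] {x y : C.ClosedPt} (hxy : x = y)
    (φ : C.X.presheaf.stalk x.1 →+* L) (ψ : C.X.presheaf.stalk y.1 →+* ℚ) [IsLocalHom φ]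
    [IsLocalHom ψ] (a b : C.Fˣ) :
    TameSymbol.tame φ a b = Units.map (algebraMap ℚ L).toMonoidHom (TameSymbol.tame ψ a b) := by
  subst hxy
  obtain ⟨ι, -⟩ := C.exists_const_stalk x.1
  have hφ : ∀ r, φ r = algebraMap ℚ L (ψ r) := by
    intro r
    have h1 : ψ (r - ι (ψ r)) = 0 := by
      have : ψ (ι (ψ r)) = ψ r :=
        RingHom.congr_fun (Subsingleton.elim (ψ.comp ι) (RingHom.id ℚ)) _
      rw [map_sub, this, sub_self]
    have h2 : φ (r - ι (ψ r)) = 0 := by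
      by_contra hne
      exact ((isUnit_of_map_unit φ _ (isUnit_iff_ne_zero.2 hne)).map ψ).ne_zero h1
    rw [map_sub, sub_eq_zero] at h2
    rw [h2]
    exact RingHom.congr_fun (Subsingleton.elim (φ.comp ι) (algebraMap ℚ L)) _
  have hval : ∀ u : C.Fˣ, TameSymbol.ord (C.X.presheaf.stalk x.1) u = 0 →
      TameSymbol.value φ u =
      Units.map (algebraMap ℚ L).toMonoidHom (TameSymbol.value ψ u) := by
    intro u hu
    obtain ⟨r, rfl⟩ := TameSymbol.exists_unit_of_ord_eq_zero _ hu
    rw [TameSymbol.value_map, TameSymbol.value_map]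
    ext
    exact hφ _
  unfold TameSymbol.tame
  rw [map_mul, hval _ (TameSymbol.ord_tame_arg a b), map_zpow]
  congr 2
  ext
  simp

/-- At `Q` and `R` the tame symbol is trivial by the normalisation, at `P` by reciprocity, and
elsewhere both functions are units. -/
lemma symbol_mem_K2T {P Q R : C.Point ℚ} (hQP : Q ≠ P) (hRP : R ≠ P) (hQR : Q ≠ R)
    {a g : C.Fˣ} {m n : ℕ} (hm : 0 < m) (hn : 0 < n) (ha : C.HasDivisor a (m • diff Q P))
    (hg : C.HasDivisor g (n • diff P R)) (haR : R.value a = 1) (hgQ : Q.value g = 1) :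
    K2.symbol a g ∈ C.K2T := by
  have key : ∀ T : C.Point ℚ, T = P ∨ T = Q ∨ T = R → TameSymbol.tame T.eval a g = 1 := by
    intro T hT
    change (-1) ^ (C.ord T.closedPt a * C.ord T.closedPt g) *
      T.value (a ^ C.ord T.closedPt g / g ^ C.ord T.closedPt a) = 1
    rcases hT with rfl | rfl | rfl
    · rw [ha.ord_right hQP, hg.ord_left hRP.symm, zpow_neg, div_inv_eq_mul, zpow_natCast,
        zpow_natCast, value_mul_eq_neg_one_pow hQP hRP hQR hm hn ha hg haR hgQ, neg_mul, zpow_neg,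
        ← Nat.cast_mul, zpow_natCast, inv_mul_cancel]
    · have h0 := hg.ord_other hQP hQR
      rw [h0, mul_zero, zpow_zero, zpow_zero, one_mul, one_div, ← zpow_neg, T.value_zpow h0, hgQ,
        one_zpow]
    · have h0 := ha.ord_other hQR.symm hRP
      rw [h0, zero_mul, zpow_zero, zpow_zero, one_mul, div_one, T.value_zpow h0, haR, one_zpow]
  refine AddSubgroup.mem_iInf.2 fun x => ?_
  change Additive.ofMul (TameSymbol.tame x.eval a g) = 0
  rw [ofMul_eq_zero]
  by_cases hx : ∃ T : C.Point ℚ, (T = P ∨ T = Q ∨ T = R) ∧ x.closedPt = T.closedPt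
  · obtain ⟨T, hT, hxT⟩ := hx
    rw [tame_eq_map_of_eq hxT x.eval T.eval, key T hT, map_one]
  · push Not at hx
    have h1 : C.ord x.closedPt a = 0 := ha.ord_of_ne (hx Q (by simp)) (hx P (by simp))
    have h2 : C.ord x.closedPt g = 0 := hg.ord_of_ne (hx P (by simp)) (hx R (by simp))
    unfold ord at h1 h2
    unfold TameSymbol.tame
    rw [h1, h2]
    simp [TameSymbol.value_one]

/-! ### Symbols modulo torsion -/

/-- The symbol `{a, b}` in `K₂(F)` modulo torsion, as a bilinear pairing. -/
noncomputable def symbolMod (F : Type) [Field F] :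
    Additive Fˣ →+ Additive Fˣ →+ K2 F ⧸ AddCommGroup.torsion (K2 F) :=
  AddMonoidHom.mk' (fun a => AddMonoidHom.mk'
      (fun b => QuotientAddGroup.mk (K2.symbol a.toMul b.toMul))
      (fun b b' => by
        rw [← QuotientAddGroup.mk_add]
        unfold K2.symbol
        rw [← QuotientAddGroup.mk_add, ← TensorProduct.tmul_add]
        rfl))
    (fun a a' => by
      ext b
      change (QuotientAddGroup.mk (K2.symbol (a + a').toMul b) :
          K2 F ⧸ AddCommGroup.torsion (K2 F)) =
        QuotientAddGroup.mk (K2.symbol a.toMul b) + QuotientAddGroup.mk (K2.symbol a'.toMul b)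
      rw [← QuotientAddGroup.mk_add]
      unfold K2.symbol
      rw [← QuotientAddGroup.mk_add, ← TensorProduct.add_tmul]
      rfl)

lemma symbolMod_apply {F : Type} [Field F] (a b : Fˣ) :
    symbolMod F (.ofMul a) (.ofMul b) = QuotientAddGroup.mk (K2.symbol a b) := rfl

lemma isSteinberg_symbolMod (F : Type) [Field F] : IsSteinberg (symbolMod F) := by
  intro a b hab
  rw [symbolMod_apply]
  have : K2.symbol a b = 0 :=
    (QuotientAddGroup.eq_zero_iff _).2 (AddSubgroup.subset_closure ⟨a, b, hab, rfl⟩)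
  rw [this, QuotientAddGroup.mk_zero]

lemma symbolMod_const (p q : ℚˣ) :
    symbolMod C.F (.ofMul (constUnit C p)) (.ofMul (constUnit C q)) = 0 :=
  (isSteinberg_symbolMod C.F).map_rat C.const p q

lemma symbolMod_root_of_unity {F : Type} [Field F] {u : Fˣ} {N : ℕ} (hN : N ≠ 0)
    (hu : u ^ N = 1) : symbolMod F (.ofMul u) = 0 := by
  refine AddMonoidHom.ext fun x => (nsmul_eq_zero_iff_right hN).1 ?_
  rw [← AddMonoidHom.nsmul_apply, ← map_nsmul, ← ofMul_pow, hu, ofMul_one, map_zero]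
  rfl

/-- The inclusion of `K₂ᵀ(C)` modulo torsion into `K₂(F)` modulo torsion. -/
noncomputable def inclMod (C : NonsingularCurve) :
    C.K2TModTorsion →+ K2 C.F ⧸ AddCommGroup.torsion (K2 C.F) :=
  QuotientAddGroup.map _ _ C.K2T.subtype fun _ hx => C.K2T.subtype.isOfFinAddOrder hx

lemma inclMod_injective : Function.Injective (inclMod C) := by
  rw [injective_iff_map_eq_zero]
  intro x
  refine QuotientAddGroup.induction_on x fun x hx => ?_
  rw [QuotientAddGroup.eq_zero_iff]
  have h : (x : K2 C.F) ∈ AddCommGroup.torsion (K2 C.F) := (QuotientAddGroup.eq_zero_iff _).1 hx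
  exact (AddSubmonoid.isOfFinAddOrder_coe (H := C.K2T.toAddSubmonoid)).1 h

/-! ### Triple symbols -/

lemma exists_hasDivisor {P Q : C.Point ℚ} {D : ℕ} (h : order P Q ∣ D) :
    ∃ f, C.HasDivisor f (D • diff P Q) := by
  rw [← mem_principal_iff]
  have h1 : D • diffClass P Q = 0 := addOrderOf_dvd_iff_nsmul_eq_zero.1 h
  exact (QuotientAddGroup.eq_zero_iff _).1 h1

lemma diffClass_add (P Q R : C.Point ℚ) : diffClass P Q + diffClass Q R = diffClass P R := by
  unfold diffClass
  rw [← QuotientAddGroup.mk_add]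
  simp [diff]

lemma diffClass_swap (P Q : C.Point ℚ) : diffClass P Q = -diffClass Q P := by
  unfold diffClass
  rw [← QuotientAddGroup.mk_neg]
  simp [diff]

lemma order_comm (P Q : C.Point ℚ) : order P Q = order Q P := by
  unfold order
  rw [diffClass_swap, addOrderOf_neg]

lemma order_dvd_lcm (P Q R : C.Point ℚ) : order P R ∣ (order P Q).lcm (order Q R) := by
  unfold order
  rw [← diffClass_add P Q R]
  exact (AddCommute.all _ _).addOrderOf_add_dvd_lcm

/-- If `s` is proportional to a triple of coprime weights `n`, a Bézout combination `ξ` of the `s i`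
satisfies `s i = n i • ξ`. -/
lemma exists_smul_eq {A : Type*} [AddCommGroup A] {n : Fin 3 → ℕ} (s : Fin 3 → A)
    (hn : (n 0).gcd ((n 1).gcd (n 2)) = 1) (hs : ∀ i j, n i • s j = n j • s i) :
    ∃ ξ, ∀ i, s i = n i • ξ := by
  have h1 := Nat.gcd_eq_gcd_ab (n 0) ((n 1).gcd (n 2))
  rw [hn, Nat.gcd_eq_gcd_ab (n 1) (n 2)] at h1
  set x := (n 0).gcdA ((n 1).gcd (n 2))
  set y := (n 0).gcdB ((n 1).gcd (n 2))
  set z := (n 1).gcdA (n 2)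
  set w := (n 1).gcdB (n 2)
  refine ⟨x • s 0 + (z * y) • s 1 + (w * y) • s 2, fun i => ?_⟩
  rw [smul_add, smul_add, smul_comm (n i) x, smul_comm (n i) (z * y), smul_comm (n i) (w * y),
    hs i 0, hs i 1, hs i 2, ← natCast_zsmul, ← natCast_zsmul, ← natCast_zsmul, smul_smul, smul_smul,
    smul_smul, ← add_smul, ← add_smul]
  have h2 : x * (n 0 : ℤ) + z * y * (n 1 : ℤ) + w * y * (n 2 : ℤ) = 1 := by
    push_cast at h1
    rw [h1]; ring
  rw [h2, one_smul]

lemma lcm_fin_three (m : Fin 3 → ℕ) : Finset.univ.lcm m = (m 0).lcm ((m 1).lcm (m 2)) := by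
  have h : (Finset.univ : Finset (Fin 3)) = {0, 1, 2} := by decide
  rw [h, Finset.lcm_insert, Finset.lcm_insert, Finset.lcm_singleton]
  simp [lcm_eq_nat_lcm]

/-- The cofactors of a least common multiple are coprime. -/
lemma gcd_lcm_div {m : Fin 3 → ℕ} (hm : ∀ i, 0 < m i) {n : Fin 3 → ℕ}
    (hn : ∀ i, m i * n i = Finset.univ.lcm m) : (n 0).gcd ((n 1).gcd (n 2)) = 1 := by
  set d := (n 0).gcd ((n 1).gcd (n 2)) with hd
  have hL : Finset.univ.lcm m ≠ 0 := by
    rw [Ne, Finset.lcm_eq_zero_iff]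
    rintro ⟨i, -, hi⟩
    exact (hm i).ne' hi
  have hdn : ∀ i, d ∣ n i := by
    intro i
    fin_cases i
    · exact Nat.gcd_dvd_left _ _
    · exact (Nat.gcd_dvd_right _ _).trans (Nat.gcd_dvd_left _ _)
    · exact (Nat.gcd_dvd_right _ _).trans (Nat.gcd_dvd_right _ _)
  have hdL : d ∣ Finset.univ.lcm m := (hdn 0).trans ⟨m 0, by rw [← hn 0, mul_comm]⟩
  obtain ⟨k, hk⟩ := hdL
  have hd0 : 0 < d := Nat.pos_of_ne_zero (by rintro h; rw [h, zero_mul] at hk; exact hL hk)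
  have h1 : Finset.univ.lcm m ∣ k := by
    apply Finset.lcm_dvd
    intro i _
    obtain ⟨t, ht⟩ := hdn i
    refine ⟨t, Nat.eq_of_mul_eq_mul_left hd0 ?_⟩
    rw [← hk, ← hn i, ht]
    ring
  have hk0 : 0 < k := Nat.pos_of_ne_zero (by rintro rfl; exact hL (by simpa using hk))
  have h2 := Nat.le_of_dvd hk0 h1
  rw [hk] at h2
  nlinarith

section Triple

variable {P : Fin 3 → C.Point ℚ} {m : Fin 3 → ℕ} {f : Fin 3 → C.Fˣ}

lemma normalize_triple (hP : Function.Injective P)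
    (hf : ∀ i, C.HasDivisor (f i) (m i • diff (P (i + 1)) (P (i - 1)))) (i : Fin 3) :
    C.HasDivisor (normalize (f i) (P i)) (m i • diff (P (i + 1)) (P (i - 1))) ∧
      (P i).value (normalize (f i) (P i)) = 1 := by
  refine ⟨(hf i).normalize _, value_normalize ((hf i).ord_other (hP.ne ?_) (hP.ne ?_))⟩ <;>
  fin_cases i <;> decide

lemma S_mem_K2T (hP : Function.Injective P) (hm : ∀ i, 0 < m i)
    (hf : ∀ i, C.HasDivisor (f i) (m i • diff (P (i + 1)) (P (i - 1)))) (i : Fin 3) :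
    S P f i ∈ C.K2T := by
  have h1 := normalize_triple hP hf (i + 1)
  have h2 := normalize_triple hP hf (i - 1)
  have e1 : i + 1 + 1 = i - 1 := by fin_cases i <;> rfl
  have e2 : i + 1 - 1 = i := by fin_cases i <;> rfl
  have e3 : i - 1 + 1 = i := by fin_cases i <;> rfl
  have e4 : i - 1 - 1 = i + 1 := by fin_cases i <;> rfl
  rw [e1, e2] at h1
  rw [e3, e4] at h2
  refine symbol_mem_K2T (hP.ne ?_) (hP.ne ?_) (hP.ne ?_) (hm (i + 1)) (hm (i - 1)) h1.1 h2.1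
    h1.2 h2.2 <;>
  fin_cases i <;> decide

/-- The product of suitable powers of the three normalised functions has trivial divisor, so it is
a constant; evaluating it at `P 2` and using reciprocity shows that it is a root of unity. -/
lemma symbolMod_sum_eq_zero (hP : Function.Injective P) (hm : ∀ i, 0 < m i) {g : Fin 3 → C.Fˣ}
    (hg : ∀ i, C.HasDivisor (g i) (m i • diff (P (i + 1)) (P (i - 1))))
    (hv : ∀ i, (P i).value (g i) = 1) {n : Fin 3 → ℕ} {L : ℕ} (hn : ∀ i, m i * n i = L) :
    symbolMod C.F (.ofMul (g 0 ^ n 0 * g 1 ^ n 1 * g 2 ^ n 2)) = 0 := by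
  have g0 : C.HasDivisor (g 0) (m 0 • diff (P 1) (P 2)) := hg 0
  have g1 : C.HasDivisor (g 1) (m 1 • diff (P 2) (P 0)) := hg 1
  have g2 : C.HasDivisor (g 2) (m 2 • diff (P 0) (P 1)) := hg 2
  have h01 : P 0 ≠ P 1 := hP.ne (by decide)
  have h02 : P 0 ≠ P 2 := hP.ne (by decide)
  have h12 : P 1 ≠ P 2 := hP.ne (by decide)
  have hd0 := g0.pow (n 0)
  have hd1 := g1.pow (n 1)
  have hd2 := g2.pow (n 2)
  rw [mul_comm, hn] at hd0 hd1 hd2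
  have hprod : ∀ x, C.ord x (g 0 ^ n 0 * g 1 ^ n 1 * g 2 ^ n 2) = 0 := by
    intro x
    rw [(hd0.mul hd1).mul hd2 x]
    simp [diff]
  set u := g 0 ^ n 0 * g 1 ^ n 1 * g 2 ^ n 2 with hu
  have e : u = constUnit C ((P 2).value u) := by
    refine eq_of_ord_eq (P := P 2) (fun x => ?_) (hprod _) ?_
    · rw [hprod, ord_constUnit]
    · rw [Point.value_constUnit]
  have h22 : C.ord (P 2).closedPt (g 2) = 0 := g2.ord_other h02.symm h12.symm
  have hord01 : C.ord (P 2).closedPt (g 0 ^ n 0 * g 1 ^ n 1) = 0 := by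
    have := hprod (P 2).closedPt
    rw [hu, ord_mul, ord_pow _ (g 2), h22, mul_zero, add_zero] at this
    exact this
  have hval : (P 2).value u = (P 2).value (g 0 ^ n 0 * g 1 ^ n 1) := by
    rw [hu, (P 2).value_mul hord01 (by rw [ord_pow, h22, mul_zero]), (P 2).value_pow h22, hv,
      one_pow, mul_one]
  have hsign := value_mul_eq_neg_one_pow h12 h02 h01.symm (hm 0) (hm 1) g0 g1 (hv 0) (hv 1)
  have hordw : C.ord (P 2).closedPt (g 0 ^ m 1 * g 1 ^ m 0) = 0 := by
    rw [ord_mul, ord_pow, ord_pow, g0.ord_right h12, g1.ord_left h02.symm]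
    ring
  have hroot : ((P 2).value u) ^ (m 0 * m 1 * 2) = 1 := by
    have e1 : (g 0 ^ n 0 * g 1 ^ n 1) ^ (m 0 * m 1) = (g 0 ^ m 1 * g 1 ^ m 0) ^ L := by
      rw [mul_pow, mul_pow, ← pow_mul, ← pow_mul, ← pow_mul, ← pow_mul]
      congr 2
      · rw [← hn 0]; ring
      · rw [← hn 1]; ring
    rw [hval, pow_mul, ← (P 2).value_pow hord01, e1, (P 2).value_pow hordw, hsign, ← pow_mul,
      ← pow_mul, mul_comm (m 0 * m 1), mul_comm L 2, mul_assoc, pow_mul, neg_one_sq, one_pow]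
  rw [e]
  refine symbolMod_root_of_unity (N := m 0 * m 1 * 2) ?_ ?_
  · have := hm 0; have := hm 1; positivity
  · rw [← map_pow, hroot, map_one]

/-- The symbols of the three normalised functions are proportional modulo torsion. -/
lemma smul_symbolMod_eq (hP : Function.Injective P) (hm : ∀ i, 0 < m i) {g : Fin 3 → C.Fˣ}
    (hg : ∀ i, C.HasDivisor (g i) (m i • diff (P (i + 1)) (P (i - 1))))
    (hv : ∀ i, (P i).value (g i) = 1) {n : Fin 3 → ℕ} {L : ℕ} (hL : 0 < L)
    (hn : ∀ i, m i * n i = L) (i j : Fin 3) :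
    n i • symbolMod C.F (.ofMul (g (j + 1))) (.ofMul (g (j - 1))) =
      n j • symbolMod C.F (.ofMul (g (i + 1))) (.ofMul (g (i - 1))) := by
  have hB := isSteinberg_symbolMod C.F
  set B := symbolMod C.F
  have hsum := symbolMod_sum_eq_zero hP hm hg hv hn
  have hn0 : ∀ i, n i ≠ 0 := fun i h => by
    have := hn i
    rw [h, mul_zero] at this
    omega
  have hs : ∀ x, n 0 • B (.ofMul (g 0)) x + n 1 • B (.ofMul (g 1)) x +
      n 2 • B (.ofMul (g 2)) x = 0 := fun x => by
    have := DFunLike.congr_fun hsum x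
    simpa only [ofMul_mul, ofMul_pow, map_add, map_nsmul, AddMonoidHom.add_apply,
      AddMonoidHom.nsmul_apply, AddMonoidHom.zero_apply] using this
  have h0 := hs (.ofMul (g 0))
  have h1 := hs (.ofMul (g 1))
  rw [hB.map_self, smul_zero, zero_add] at h0
  rw [hB.map_self, smul_zero, add_zero] at h1
  rw [hB.map_swap (.ofMul (g 1)) (.ofMul (g 0)), smul_neg, neg_add_eq_zero] at h0
  rw [hB.map_swap (.ofMul (g 2)) (.ofMul (g 1)), smul_neg, add_neg_eq_zero] at h1
  have h2 : n 0 • B (.ofMul (g 2)) (.ofMul (g 0)) = n 1 • B (.ofMul (g 1)) (.ofMul (g 2)) := by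
    apply (nsmul_right_injective (hn0 2))
    change n 2 • n 0 • _ = n 2 • n 1 • _
    rw [smul_comm (n 2) (n 0), ← h0, smul_comm (n 2) (n 1), ← h1, smul_comm]
  have key : ∀ i j : Fin 3, n i • B (.ofMul (g (j + 1))) (.ofMul (g (j - 1))) =
      n j • B (.ofMul (g (i + 1))) (.ofMul (g (i - 1))) := by
    intro i j
    fin_cases i <;> fin_cases j
    · rfl
    · exact h2
    · exact h1
    · exact h2.symm
    · rfl
    · exact h0
    · exact h1.symm
    · exact h0.symm
    · rfl
  exact key i j

end Triple

section TripleSymbol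

variable {P : Fin 3 → C.Point ℚ}

lemma order_pos (h : ∀ i j, IsOfFinAddOrder (diffClass (P i) (P j))) (i j : Fin 3) :
    0 < order (P i) (P j) := (h i j).addOrderOf_pos

/-- The symbols `S_i` do not depend on the choice of the functions. -/
lemma S_eq_of_hasDivisor (hP : Function.Injective P) {m : Fin 3 → ℕ} {f f' : Fin 3 → C.Fˣ}
    (hf : ∀ i, C.HasDivisor (f i) (m i • diff (P (i + 1)) (P (i - 1))))
    (hf' : ∀ i, C.HasDivisor (f' i) (m i • diff (P (i + 1)) (P (i - 1)))) (i : Fin 3) :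
    S P f i = S P f' i := by
  have h : ∀ i, normalize (f i) (P i) = normalize (f' i) (P i) := fun i => by
    have h1 := normalize_triple hP hf i
    have h2 := normalize_triple hP hf' i
    refine eq_of_ord_eq (P := P i) (fun x => by rw [h1.1 x, h2.1 x])
      (h1.1.ord_other (hP.ne ?_) (hP.ne ?_)) (by rw [h1.2, h2.2]) <;>
    fin_cases i <;> decide
  rw [S, S, h, h]

/-- The triple symbol is well defined. -/
theorem existsUnique_isTripleSymbol (hP : Function.Injective P)
    (htors : ∀ i j, IsOfFinAddOrder (diffClass (P i) (P j))) :
    ∃! ξ : C.K2TModTorsion, IsTripleSymbol P ξ := by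
  set m : Fin 3 → ℕ := fun i => order (P (i + 1)) (P (i - 1)) with hm
  have hpos : ∀ i, 0 < m i := fun i => order_pos htors _ _
  choose f hf using fun i => exists_hasDivisor (dvd_refl (m i))
  have hL : 0 < Finset.univ.lcm m := by
    apply Nat.pos_of_ne_zero
    rw [Ne, Finset.lcm_eq_zero_iff]
    rintro ⟨i, -, hi⟩
    exact (hpos i).ne' hi
  have hdvd : ∀ i, m i ∣ Finset.univ.lcm m := fun i => Finset.dvd_lcm (Finset.mem_univ i)
  set n : Fin 3 → ℕ := fun i => Finset.univ.lcm m / m i with hndef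
  have hn : ∀ i, m i * n i = Finset.univ.lcm m := fun i => Nat.mul_div_cancel' (hdvd i)
  have hn0 : ∀ i, n i ≠ 0 := fun i h => by
    have := hn i
    rw [h, mul_zero] at this
    omega
  have hmem := S_mem_K2T hP hpos hf
  let s : Fin 3 → C.K2TModTorsion := fun i => QuotientAddGroup.mk ⟨S P f i, hmem i⟩
  obtain ⟨ξ, hξ⟩ := exists_smul_eq s (gcd_lcm_div hpos hn) (fun i j => by
    apply inclMod_injective
    rw [map_nsmul, map_nsmul]
    exact smul_symbolMod_eq hP hpos (fun i => (normalize_triple hP hf i).1)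
      (fun i => (normalize_triple hP hf i).2) hL hn i j)
  refine ⟨ξ, ?_, fun η hη => ?_⟩
  · intro f' hf' i
    refine ⟨S_mem_K2T hP hpos hf' i, ?_⟩
    rw [← hξ i]
    congr 2
    exact S_eq_of_hasDivisor hP hf' hf i
  · obtain ⟨hS, h⟩ := hη f hf 0
    refine nsmul_right_injective (hn0 0) ?_
    change n 0 • η = n 0 • ξ
    rw [← hξ 0]
    exact h.symm

/-- The triple symbol in terms of functions of a common degree `D`: these are powers of the
normalised functions, and `e` is the product of the three orders divided by their least common
multiple. -/
lemma IsTripleSymbol.smul_symbolMod (hP : Function.Injective P)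
    (htors : ∀ i j, IsOfFinAddOrder (diffClass (P i) (P j))) {ξ : C.K2TModTorsion}
    (hξ : IsTripleSymbol P ξ) {D e : ℕ} (hD : ∀ i j, order (P i) (P j) ∣ D)
    (he : e * (order (P 1) (P 2)).lcm ((order (P 2) (P 0)).lcm (order (P 0) (P 1))) =
      order (P 1) (P 2) * (order (P 2) (P 0) * order (P 0) (P 1)))
    {γ₀ γ₁ : C.Fˣ} (h₀ : C.HasDivisor γ₀ (D • diff (P 1) (P 2)))
    (h₁ : C.HasDivisor γ₁ (D • diff (P 2) (P 0)))
    (hv₀ : (P 0).value γ₀ = 1) (hv₁ : (P 1).value γ₁ = 1) :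
    e • symbolMod C.F (.ofMul γ₀) (.ofMul γ₁) = D ^ 2 • inclMod C ξ := by
  set m : Fin 3 → ℕ := fun i => order (P (i + 1)) (P (i - 1)) with hm
  have hpos : ∀ i, 0 < m i := fun i => order_pos htors _ _
  choose f hf using fun i => exists_hasDivisor (dvd_refl (m i))
  obtain ⟨hS, h⟩ := hξ f hf 2
  have hg := normalize_triple hP hf
  have h01 : P 0 ≠ P 1 := hP.ne (by decide)
  have h02 : P 0 ≠ P 2 := hP.ne (by decide)
  have h12 : P 1 ≠ P 2 := hP.ne (by decide)
  have g0 : C.HasDivisor (normalize (f 0) (P 0)) (m 0 • diff (P 1) (P 2)) := (hg 0).1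
  have g1 : C.HasDivisor (normalize (f 1) (P 1)) (m 1 • diff (P 2) (P 0)) := (hg 1).1
  obtain ⟨k0, hk0⟩ : m 0 ∣ D := hD _ _
  obtain ⟨k1, hk1⟩ : m 1 ∣ D := hD _ _
  have e0 : γ₀ = normalize (f 0) (P 0) ^ k0 := by
    refine eq_of_ord_eq (P := P 0) (fun x => ?_) (h₀.ord_other h01 h02) ?_
    · rw [h₀ x, g0.pow k0 x, mul_comm, hk0]
    · rw [hv₀, (P 0).value_pow (g0.ord_other h01 h02), (hg 0).2, one_pow]
  have e1 : γ₁ = normalize (f 1) (P 1) ^ k1 := by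
    refine eq_of_ord_eq (P := P 1) (fun x => ?_) (h₁.ord_other h12 h01.symm) ?_
    · rw [h₁ x, g1.pow k1 x, mul_comm, hk1]
    · rw [hv₁, (P 1).value_pow (g1.ord_other h12 h01.symm), (hg 1).2, one_pow]
  have hS2 : symbolMod C.F (.ofMul (normalize (f 0) (P 0))) (.ofMul (normalize (f 1) (P 1))) =
      (Finset.univ.lcm m / m 2) • inclMod C ξ := by
    rw [← map_nsmul, ← h]
    rfl
  have hL : m 2 * (Finset.univ.lcm m / m 2) = Finset.univ.lcm m :=
    Nat.mul_div_cancel' (Finset.dvd_lcm (Finset.mem_univ 2))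
  have he' : e * (Finset.univ.lcm m / m 2) = m 0 * m 1 := by
    apply Nat.eq_of_mul_eq_mul_left (hpos 2)
    have he2 : e * Finset.univ.lcm m = m 0 * (m 1 * m 2) := by
      rw [lcm_fin_three]
      exact he
    rw [mul_left_comm, hL, he2]
    ring
  rw [e0, e1, ofMul_pow, ofMul_pow, map_nsmul, map_nsmul, AddMonoidHom.nsmul_apply, hS2, smul_smul,
    smul_smul, smul_smul]
  congr 1
  calc e * k1 * k0 * (Finset.univ.lcm m / m 2) =
        (e * (Finset.univ.lcm m / m 2)) * k0 * k1 := by ring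
    _ = (m 0 * k0) * (m 1 * k1) := by rw [he']; ring
    _ = D ^ 2 := by rw [← hk0, ← hk1, sq]

end TripleSymbol

/-! ### The relation for four points -/

/-- Reciprocity for functions `a`, `b` with a common pole of the same order whose ratio is one
there: the mutual values `b(Q)` and `a(R)` agree up to a root of unity. -/
lemma symbolMod_value_comm {P Q R : C.Point ℚ} (hQP : Q ≠ P) (hRP : R ≠ P) (hQR : Q ≠ R)
    {a b : C.Fˣ} {D : ℕ} (hD : 0 < D) (ha : C.HasDivisor a (D • diff Q P))
    (hb : C.HasDivisor b (D • diff R P)) (hab : P.value (b / a) = 1) :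
    symbolMod C.F (.ofMul (constUnit C (Q.value b))) =
      symbolMod C.F (.ofMul (constUnit C (R.value a))) := by
  obtain ⟨d, hdD, hd⟩ := weil_reciprocity hQP hRP hQR hD ha hb
  have hord : C.ord P.closedPt (b / a) = 0 := by
    rw [ord_div, ha.ord_right hQP, hb.ord_right hRP, sub_self]
  have hd0 : d ≠ 0 := by rintro rfl; rw [zero_dvd_iff] at hdD; omega
  rw [← div_pow, P.value_pow hord, hab, one_pow, Units.val_one, one_mul, ← pow_mul,
    ← pow_mul] at hd
  have h1 : (Q.value b / R.value a) ^ (D * d * 2) = 1 := by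
    ext
    have hne := (R.value a).ne_zero
    rw [Units.val_pow_eq_pow_val, Units.val_div_eq_div_val, div_pow, pow_mul, hd, ← pow_mul,
      (even_two.mul_left (D * d)).neg_pow, div_self (pow_ne_zero _ hne), Units.val_one]
  have h2 := symbolMod_root_of_unity (F := C.F) (N := D * d * 2) (by positivity)
    (u := constUnit C (Q.value b / R.value a)) (by rw [← map_pow, h1, map_one])
  rwa [map_div, ofMul_div, map_sub, sub_eq_zero] at h2

lemma gcd_erase_fin_four (m : Fin 4 → ℕ) :
    (Finset.univ.erase 0).gcd m = (m 1).gcd ((m 2).gcd (m 3)) ∧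
    (Finset.univ.erase 1).gcd m = (m 0).gcd ((m 2).gcd (m 3)) ∧
    (Finset.univ.erase 2).gcd m = (m 0).gcd ((m 1).gcd (m 3)) ∧
    (Finset.univ.erase 3).gcd m = (m 0).gcd ((m 1).gcd (m 2)) := by
  have h0 : (Finset.univ : Finset (Fin 4)).erase 0 = {1, 2, 3} := by decide
  have h1 : (Finset.univ : Finset (Fin 4)).erase 1 = {0, 2, 3} := by decide
  have h2 : (Finset.univ : Finset (Fin 4)).erase 2 = {0, 1, 3} := by decide
  have h3 : (Finset.univ : Finset (Fin 4)).erase 3 = {0, 1, 2} := by decide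
  rw [h0, h1, h2, h3]
  simp only [Finset.gcd_insert, Finset.gcd_singleton, normalize_eq]
  exact ⟨rfl, rfl, rfl, rfl⟩

/-- The coefficient of the `i`-th triple symbol, rescaled by the weight of the triple opposite
to `i`, is the same for all `i`. -/
lemma gcd_mul_weight_eq {ι : Type*} {m : ι → ι → ℕ} (hpos : ∀ i j, 0 < m i j)
    (hsymm : ∀ i j, m i j = m j i) (hdvd : ∀ i j k, m i k ∣ (m i j).lcm (m j k)) (i j k l : ι)
    {x y : ℕ} (hx : x * (m j k).lcm ((m j l).lcm (m k l)) = m j k * (m j l * m k l))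
    (hy : y * (m i k).lcm ((m i l).lcm (m k l)) = m i k * (m i l * m k l)) :
    (m i j).gcd ((m i k).gcd (m i l)) * x = (m i j).gcd ((m j k).gcd (m j l)) * y := by
  have h : ∀ a b c, m a b ∣ (m a c).lcm (m b c) := fun a b c => by
    rw [hsymm b c]; exact hdvd a c b
  have h' : ∀ a b c, m a b ∣ (m c a).lcm (m c b) := fun a b c => by
    rw [hsymm c a]; exact hdvd a c b
  exact Nat.gcd_mul_div_lcm_eq (hpos _ _) (hpos _ _) (hpos _ _) (hpos _ _) (hpos _ _) (hpos _ _)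
    (h _ _ _) (hdvd _ _ _) (h' _ _ _) (h _ _ _) (hdvd _ _ _) (h' _ _ _) (h _ _ _) (hdvd _ _ _)
    (h' _ _ _) (h _ _ _) (hdvd _ _ _) (h' _ _ _) hx hy

lemma HasDivisor.div {f g : C.Fˣ} {P Q R : C.Point ℚ} {D : ℕ} (hf : C.HasDivisor f (D • diff P R))
    (hg : C.HasDivisor g (D • diff Q R)) : C.HasDivisor (f / g) (D • diff P Q) := by
  rw [div_eq_mul_inv]
  exact hf.mul hg.inv

lemma HasDivisor.mul_const {f : C.Fˣ} {E : C.Divisor} (hf : C.HasDivisor f E) (q : ℚˣ) :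
    C.HasDivisor (f * constUnit C q) E := fun x => by
  rw [ord_mul, ord_constUnit, add_zero, hf x]

lemma Point.value_mul_const (P : C.Point ℚ) {f : C.Fˣ} (hf : C.ord P.closedPt f = 0) (q : ℚˣ) :
    P.value (f * constUnit C q) = P.value f * q := by
  rw [P.value_mul hf (ord_constUnit _ _), P.value_constUnit]

/-- Functions with a common pole and pairwise ratios of value one there. -/
lemma exists_normalized_family {P : Fin 4 → C.Point ℚ} (hP : Function.Injective P) {D : ℕ}
    (hD : ∀ i j, order (P i) (P j) ∣ D) :
    ∃ φ : Fin 4 → C.Fˣ, (∀ j, C.HasDivisor (φ j) (D • diff (P j) (P 3))) ∧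
      ∀ j k, j ≠ 3 → k ≠ 3 → (P 3).value (φ k / φ j) = 1 := by
  choose f hf using fun j => exists_hasDivisor (hD j 3)
  have hord : ∀ j k, j ≠ 3 → k ≠ 3 → C.ord (P 3).closedPt (f k / f j) = 0 := by
    intro j k hj hk
    rw [ord_div, (hf j).ord_right (hP.ne hj), (hf k).ord_right (hP.ne hk), sub_self]
  refine ⟨fun j => f j * constUnit C ((P 3).value (f j / f 0))⁻¹,
    fun j => (hf j).mul_const _, fun j k hj hk => ?_⟩
  have h0 := hord 0 j (by decide) hj
  have e : (f k / f 0) = (f k / f j) * (f j / f 0) := (div_mul_div_cancel _ _ _).symm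
  rw [mul_div_mul_comm, ← map_div, Point.value_mul_const _ (hord j k hj hk), e,
    (P 3).value_mul (hord j k hj hk) h0]
  simp

/-- The relation between the four triple symbols. -/
theorem sum_gcd_smul_eq_zero {P : Fin 4 → C.Point ℚ} (hP : Function.Injective P)
    (htors : ∀ i j, IsOfFinAddOrder (diffClass (P i) (P j))) {ξ : Fin 4 → C.K2TModTorsion}
    (hξ : ∀ i, IsTripleSymbol (P ∘ i.succAbove) (ξ i)) :
    ∑ i : Fin 4, (-1 : ℤ) ^ (i.val + 1) •
      ((Finset.univ.erase i).gcd fun j => order (P i) (P j)) • ξ i = 0 := by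
  have hinj : ∀ i : Fin 4, Function.Injective (P ∘ i.succAbove) := fun i =>
    hP.comp Fin.succAbove_right_injective
  set m : Fin 4 → Fin 4 → ℕ := fun i j => order (P i) (P j) with hm
  have hpos : ∀ i j, 0 < m i j := fun i j => (htors i j).addOrderOf_pos
  have hsymm : ∀ i j, m i j = m j i := fun i j => order_comm _ _
  have hdvd : ∀ i j k, m i k ∣ (m i j).lcm (m j k) := fun i j k => order_dvd_lcm _ _ _
  set D : ℕ := ∏ i, ∏ j, m i j with hDdef
  have hD : ∀ i j, order (P i) (P j) ∣ D := fun i j =>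
    (Finset.dvd_prod_of_mem (m i) (Finset.mem_univ j)).trans
      (Finset.dvd_prod_of_mem (fun i => ∏ j, m i j) (Finset.mem_univ i))
  have hD0 : 0 < D := Finset.prod_pos fun i _ => Finset.prod_pos fun j _ => hpos i j
  obtain ⟨φ, hφ, hφ1⟩ := exists_normalized_family hP hD
  have hB := isSteinberg_symbolMod C.F
  have hne : ∀ {i j : Fin 4}, i ≠ j → P i ≠ P j := fun h => hP.ne h
  -- the mutual values `φ j (P k)`
  set κ : Fin 4 → Fin 4 → ℚˣ := fun j k => (P k).value (φ j) with hκ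
  have hord : ∀ {j k : Fin 4}, k ≠ j → k ≠ 3 → C.ord (P k).closedPt (φ j) = 0 := fun h h' =>
    (hφ _).ord_other (hne h) (hne h')
  have hκs : ∀ {j k : Fin 4}, j ≠ 3 → k ≠ 3 → j ≠ k →
      symbolMod C.F (.ofMul (constUnit C (κ k j))) =
        symbolMod C.F (.ofMul (constUnit C (κ j k))) := fun {j k} hj hk hjk =>
    symbolMod_value_comm (hne hj) (hne hk) (hne hjk) hD0 (hφ j) (hφ k) (hφ1 j k hj hk)
  have hweight : ∀ i j k, ∃ e, e * (m i j).lcm ((m j k).lcm (m k i)) = m i j * (m j k * m k i) :=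
    fun i j k => by
      have h : (m i j).lcm ((m j k).lcm (m k i)) ∣ m i j * (m j k * m k i) :=
        Nat.lcm_dvd (dvd_mul_right _ _) (Nat.lcm_dvd ((dvd_mul_right _ _).mul_left _)
          ((dvd_mul_left _ _).mul_left _))
      exact ⟨_, Nat.div_mul_cancel h⟩
  -- the triple `(j, k, 3)`, whose functions are `φ k / φ k (P j)` and `φ j (P k) / φ j`
  have htriple3 : ∀ (i j k : Fin 4), j ≠ 3 → k ≠ 3 → j ≠ k → (P ∘ i.succAbove) 0 = P j →
      (P ∘ i.succAbove) 1 = P k → (P ∘ i.succAbove) 2 = P 3 → ∀ e,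
      e * (m k 3).lcm ((m 3 j).lcm (m j k)) = m k 3 * (m 3 j * m j k) →
      e • symbolMod C.F (.ofMul (φ k) - .ofMul (constUnit C (κ k j)))
        (-.ofMul (φ j) + .ofMul (constUnit C (κ j k))) = D ^ 2 • inclMod C (ξ i) := by
    intro i j k hj hk hjk h0 h1 h2 e he
    have := (hξ i).smul_symbolMod (hinj i) (fun _ _ => htors _ _) (D := D) (e := e)
      (fun _ _ => hD _ _) (by rw [h0, h1, h2]; exact he)
      (γ₀ := φ k * constUnit C (κ k j)⁻¹)
      (γ₁ := (φ j)⁻¹ * constUnit C (κ j k))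
      (by rw [h1, h2]; exact (hφ k).mul_const _)
      (by rw [h0, h2]; exact (hφ j).inv.mul_const _)
      (by rw [h0, (P j).value_mul_const (hord hjk hj)]; simp [hκ])
      (by
        have h := hord hjk.symm hk
        rw [h1, (P k).value_mul_const (by rw [ord_inv, h, neg_zero]), (P k).value_inv h]
        simp [hκ])
    rw [← this]
    simp only [ofMul_mul, map_inv, ofMul_inv, sub_eq_add_neg]
  obtain ⟨e₀, he₀⟩ := hweight 2 3 1
  obtain ⟨e₁, he₁⟩ := hweight 2 3 0
  obtain ⟨e₂, he₂⟩ := hweight 1 3 0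
  obtain ⟨e₃, he₃⟩ := hweight 1 2 0
  have t0 := htriple3 0 1 2 (by decide) (by decide) (by decide) rfl rfl rfl e₀ he₀
  have t1 := htriple3 1 0 2 (by decide) (by decide) (by decide) rfl rfl rfl e₁ he₁
  have t2 := htriple3 2 0 1 (by decide) (by decide) (by decide) rfl rfl rfl e₂ he₂
  -- the triple `(0, 1, 2)`, whose functions come from `φ 1 / φ 2` and `φ 2 / φ 0`
  have t3 : e₃ • symbolMod C.F
      (.ofMul (φ 1) - .ofMul (φ 2) - .ofMul (constUnit C (κ 1 0)) +
        .ofMul (constUnit C (κ 2 0)))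
      (.ofMul (φ 2) - .ofMul (φ 0) - .ofMul (constUnit C (κ 2 1)) +
        .ofMul (constUnit C (κ 0 1))) = D ^ 2 • inclMod C (ξ 3) := by
    have h10 : C.ord (P 0).closedPt (φ 1) = 0 := hord (by decide) (by decide)
    have h20 : C.ord (P 0).closedPt (φ 2) = 0 := hord (by decide) (by decide)
    have h21 : C.ord (P 1).closedPt (φ 2) = 0 := hord (by decide) (by decide)
    have h01 : C.ord (P 1).closedPt (φ 0) = 0 := hord (by decide) (by decide)
    have := (hξ 3).smul_symbolMod (hinj 3) (fun _ _ => htors _ _) (D := D) (e := e₃)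
      (fun _ _ => hD _ _) he₃
      (γ₀ := φ 1 / φ 2 * constUnit C ((κ 1 0)⁻¹ * κ 2 0))
      (γ₁ := φ 2 / φ 0 * constUnit C ((κ 2 1)⁻¹ * κ 0 1))
      (((hφ 1).div (hφ 2)).mul_const _) (((hφ 2).div (hφ 0)).mul_const _)
      (by
        change (P 0).value _ = 1
        rw [(P 0).value_mul_const (by rw [ord_div, h10, h20, sub_zero]), (P 0).value_div h10 h20]
        simp [hκ])
      (by
        change (P 1).value _ = 1
        rw [(P 1).value_mul_const (by rw [ord_div, h21, h01, sub_zero]), (P 1).value_div h21 h01]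
        simp [hκ])
    rw [← this]
    simp only [ofMul_mul, map_mul, map_inv, ofMul_inv, ofMul_div, sub_eq_add_neg, add_assoc]
  have hcoc := cocycle_relation (symbolMod C.F) hB.map_self (.ofMul (φ 0)) (.ofMul (φ 1))
    (.ofMul (φ 2)) (.ofMul (constUnit C (κ 0 1))) (.ofMul (constUnit C (κ 1 0)))
    (.ofMul (constUnit C (κ 0 2))) (.ofMul (constUnit C (κ 2 0)))
    (.ofMul (constUnit C (κ 1 2))) (.ofMul (constUnit C (κ 2 1)))
    (hκs (by decide) (by decide) (by decide)) (hκs (by decide) (by decide) (by decide))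
    (hκs (by decide) (by decide) (by decide)) (symbolMod_const _ _) (symbolMod_const _ _)
    (symbolMod_const _ _)
  obtain ⟨c0, -, -, -⟩ := gcd_erase_fin_four (m 0)
  obtain ⟨-, c1, -, -⟩ := gcd_erase_fin_four (m 1)
  obtain ⟨-, -, c2, -⟩ := gcd_erase_fin_four (m 2)
  obtain ⟨-, -, -, c3⟩ := gcd_erase_fin_four (m 3)
  set c : Fin 4 → ℕ := fun i => (Finset.univ.erase i).gcd (m i) with hc
  have hrev : ∀ {x y z e : ℕ}, e * x.lcm (y.lcm z) = x * (y * z) →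
      e * z.lcm (y.lcm x) = z * (y * x) := fun {x y z e} h => by
    rw [Nat.lcm_comm y x, ← Nat.lcm_assoc, Nat.lcm_comm z x, Nat.lcm_assoc, Nat.lcm_comm z y, h]
    ring
  have hswap : ∀ {x y z e : ℕ}, e * x.lcm (y.lcm z) = x * (y * z) →
      e * y.lcm (x.lcm z) = y * (x * z) := fun {x y z e} h => by
    rw [← Nat.lcm_assoc, Nat.lcm_comm y x, Nat.lcm_assoc, h]
    ring
  rw [hsymm 3 1] at he₀
  rw [hsymm 3 0] at he₁ he₂
  rw [hsymm 2 0] at he₃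
  have w01 : c 0 * e₀ = c 1 * e₁ := by
    have := gcd_mul_weight_eq hpos hsymm hdvd 0 1 2 3 (hrev he₀) (hrev he₁)
    simp only [hc, c0, c1]
    rw [this, hsymm 0 1]
  have w02 : c 0 * e₀ = c 2 * e₂ := by
    have := gcd_mul_weight_eq hpos hsymm hdvd 0 2 1 3
      (by rw [hsymm 2 1]; exact hrev (hswap he₀)) (hrev he₂)
    simp only [hc, c0, c2]
    rw [Nat.gcd_left_comm, this, hsymm 0 2]
  have w03 : c 0 * e₀ = c 3 * e₃ := by
    have := gcd_mul_weight_eq hpos hsymm hdvd 0 3 1 2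
      (by rw [hsymm 3 1, hsymm 3 2]; exact hswap he₀) (hrev he₃)
    simp only [hc, c0, c3]
    rw [Nat.gcd_comm (m 0 2), Nat.gcd_left_comm, this, hsymm 0 3]
  apply inclMod_injective
  -- after multiplication by `D ^ 2` this is a common multiple of the cocycle relation
  refine nsmul_right_injective (pow_ne_zero 2 hD0.ne') ?_
  rw [Fin.sum_univ_four]
  simp only [map_zero, smul_zero, map_add, map_zsmul, map_nsmul]
  have hmul : ∀ i : Fin 4, ∀ (z : ℤ), D ^ 2 • z • c i • inclMod C (ξ i) =
      z • c i • D ^ 2 • inclMod C (ξ i) := fun i z => by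
    rw [smul_comm (D ^ 2) z, smul_comm (D ^ 2) (c i)]
  change D ^ 2 • ((-1 : ℤ) ^ (0 + 1) • c 0 • inclMod C (ξ 0) +
    (-1 : ℤ) ^ (1 + 1) • c 1 • inclMod C (ξ 1) + (-1 : ℤ) ^ (2 + 1) • c 2 • inclMod C (ξ 2) +
    (-1 : ℤ) ^ (3 + 1) • c 3 • inclMod C (ξ 3)) = 0
  rw [smul_add, smul_add, smul_add, hmul, hmul, hmul, hmul, ← t0, ← t1, ← t2, ← t3,
    smul_smul (c 0), smul_smul (c 1), smul_smul (c 2), smul_smul (c 3), ← w01, ← w02, ← w03]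
  have h := congrArg (fun t => (c 0 * e₀) • t) hcoc
  simp only [smul_zero] at h
  rw [smul_add, smul_sub, smul_add, smul_neg] at h
  have s0 : (-1 : ℤ) ^ (0 + 1) = -1 := rfl
  have s1 : (-1 : ℤ) ^ (1 + 1) = 1 := rfl
  have s2 : (-1 : ℤ) ^ (2 + 1) = -1 := rfl
  have s3 : (-1 : ℤ) ^ (3 + 1) = 1 := rfl
  rw [s0, s1, s2, s3, neg_smul, neg_smul, one_smul, one_smul, one_smul, one_smul,
    ← sub_eq_add_neg]
  exact h

end NonsingularCurve

theorem proposition4p4 (C : NonsingularCurve) (P : Fin 4 → C.Point ℚ)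
    (hP : Function.Injective P)
    (htors : ∀ i j, IsOfFinAddOrder (NonsingularCurve.diffClass (P i) (P j))) :
    (∀ i : Fin 4, ∃! ξ : C.K2TModTorsion,
      NonsingularCurve.IsTripleSymbol (P ∘ i.succAbove) ξ) ∧
    ∀ ξ : Fin 4 → C.K2TModTorsion,
      (∀ i, NonsingularCurve.IsTripleSymbol (P ∘ i.succAbove) (ξ i)) →
      ¬ LinearIndependent ℤ ξ ∧
      ∑ i : Fin 4, (-1 : ℤ) ^ (i.val + 1) •
        ((Finset.univ.erase i).gcd fun j => NonsingularCurve.order (P i) (P j)) • ξ i = 0 := by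
  refine ⟨fun i => NonsingularCurve.existsUnique_isTripleSymbol
    (hP.comp Fin.succAbove_right_injective) fun _ _ => htors _ _, fun ξ hξ => ?_⟩
  have hrel := NonsingularCurve.sum_gcd_smul_eq_zero hP htors hξ
  refine ⟨fun hli => ?_, hrel⟩
  have h1 := Fintype.linearIndependent_iff.1 hli
    (fun i => (-1 : ℤ) ^ (i.val + 1) *
      ((Finset.univ.erase i).gcd fun j => NonsingularCurve.order (P i) (P j) : ℕ)) (by
      rw [← hrel]
      refine Finset.sum_congr rfl fun i _ => ?_
      rw [mul_smul, natCast_zsmul]) 0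
  -- the coefficient of the first symbol is a gcd of positive integers
  have h2 : ((Finset.univ.erase 0).gcd fun j => NonsingularCurve.order (P 0) (P j)) = 0 := by
    simpa using h1
  rw [(NonsingularCurve.gcd_erase_fin_four _).1] at h2
  exact (Nat.gcd_pos_of_pos_left _ (htors 0 1).addOrderOf_pos).ne' h2
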